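/- Let $q$ be an odd prime power, let $n>1$ be an integer with $\gcd(n,q)=1$, and put $R=\mathbb F_q[x]/\langle x^n+1\rangle$. The weight of an element $\sum_{i=0}^{n-1}f_ix^i$ of $R$ is the number of non-zero $f_i$. Let $m$ be the multiplicative order of $q$ modulo $2n$, let $\zeta$ be a primitive $2n$-th root of unity in an extension field of $\mathbb F_q$, and let $\xi$ be a generator of $\mathbb F_q^*$. Let $\rho$ be the negacyclic shift $f\mapsto xf$ of $R$, $\sigma_\xi$ the multiplication by $\xi$, and, for an integer $b$ coprime to $2n$, $\mu_b$ the map $\sum_{i=0}^{n-1} f_ix^i\mapsto\sum_{i=0}^{n-1} f_ix^{bi}$ (where $x$ is invertible in $R$). Let $a\ge 0$ be an integer and let $\Gamma=\{(1+2a)q^i : i\ge 0\}\subseteq\mathbb Z/2n\mathbb Z$ be the $q$-cyclotomic coset of $1+2a$, with $k=|\Gamma|$. Let $\varepsilon=\sum_{j\in\Gamma}\frac1n\sum_{l=0}^{n-1}\zeta^{-jl}x^l\in R$ be the corresponding primitive idempotent. Suppose that $-(1+2a)\notin\Gamma$. Let $\mathcal C=R\varepsilon+\mu_{-1}(R\varepsilon)$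 and $\mathcal C^*=\mathcal C\setminus\{0\}$. Then the sum is direct, the group $\langle\mu_{-1},\mu_q,\rho,\sigma_\xi\rangle$ maps $\mathcal C$ onto itself, and the following hold. (1) Write $d_h=\gcd\big(q^h-1,\frac{q^k-1}{q-1},\frac{(1+2a)(q^k-1)}{2n}\big)$. The number of $\langle\mu_{-1},\mu_q,\rho,\sigma_\xi\rangle$-orbits of $\mathcal C^*$ is $$N=\frac1k\sum_{h\mid k}\varphi\Big(\frac kh\Big)d_h+\frac1{2m}\sum_{h=0}^{m-1}\left(\gcd\Big(q^{\gcd(k,2h)}-1,\frac{2(q^k-1)}{q-1},\frac{(1+2a)(q^h-1)(q^k-1)}{2n}\Big)+\gcd\Big((q^{\gcd(k,h)}-1)\,d_{\gcd(k,h)},\frac{2(1+2a)(q^k-1)^2}{2n(q-1)}\Big)\right).$$ (2) $N$ is strictly smaller than the number of $\langle\mu_q,\rho,\sigma_\xi\rangle$-orbits of $\mathcal C^*$, which is equal to $$\frac1k\sum_{h\mid k}\varphi\Big(\frac kh\Big)\left(2d_h+\gcd\Big((q^h-1)\,d_h,\frac{2(1+2a)(q^k-1)^2}{2n(q-1)}\Big)\right).$$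 (3) The number of distinct weights of the elements of $\mathcal C^*$ is at most $N$, with equality if and only if for any two $\mathbf c_1,\mathbf c_2\in\mathcal C^*$ of the same weight there are integers $0\le j_0\le 1$, $0\le j_1\le m-1$, $0\le j_2\le n-1$, $0\le j_3\le q-2$ with $\mu_{-1}^{j_0}\mu_q^{j_1}\rho^{j_2}\sigma_\xi^{j_3}(\mathbf c_1)=\mathbf c_2$. -/

import Mathlib

open Polynomial

noncomputable section

/-- The ring `F[x] / ⟨x^n - (-1)⟩`, the ambient space of the negacyclic codes of length `n`. -/
abbrev NegaRing (F : Type*) [Field F] (n : ℕ) : Type _ :=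
  AdjoinRoot (X ^ n - C (-1) : F[X])

namespace NegaRing

lemma odd_of_isCoprime (n : ℕ) {a : ℤ} (ha : IsCoprime a ((2 * n : ℕ) : ℤ)) : Odd a := by
  have h : IsCoprime a (2 : ℤ) := by
    push_cast at ha
    exact ha.of_mul_right_left
  rcases Int.even_or_odd a with he | ho
  · exact absurd (Int.isUnit_iff.mp (h.symm.isUnit_of_dvd he.two_dvd)) (by norm_num)
  · exact ho

section Basic

variable (F : Type*) [Field F] (n : ℕ)

lemma root_pow : (AdjoinRoot.root (X ^ n - C (-1) : F[X])) ^ n = -1 := by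
  have h := AdjoinRoot.eval₂_root (X ^ n - C (-1) : F[X])
  rw [eval₂_sub, eval₂_X_pow, eval₂_C, sub_eq_zero] at h
  have e : ∀ p : F[X], AdjoinRoot.of p (-1) = -1 := fun p => by simp
  exact h.trans (e _)

lemma monic_modulus [NeZero n] : (X ^ n - C (-1) : F[X]).Monic :=
  monic_X_pow_sub_C _ (NeZero.ne n)

/-- The class of `x`, which is invertible since `x * (-x^(n-1)) = 1`. -/
def x [NeZero n] : (NegaRing F n)ˣ where
  val := AdjoinRoot.root (X ^ n - C (-1) : F[X])
  inv := -(AdjoinRoot.root (X ^ n - C (-1) : F[X])) ^ (n - 1)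
  val_inv := by
    rw [mul_neg, mul_pow_sub_one (NeZero.ne n), root_pow, neg_neg]
  inv_val := by
    rw [neg_mul, pow_sub_one_mul (NeZero.ne n), root_pow, neg_neg]

variable [NeZero n]

lemma x_pow : (x F n) ^ n = -1 := by
  ext
  simpa [x] using root_pow F n

/-- The coordinates `(a_0, …, a_{n-1})` of `a_0 + a_1 x + ⋯ + a_{n-1} x^{n-1}`. -/
def word (c : NegaRing F n) : Fin n → F :=
  fun i => (AdjoinRoot.modByMonicHom (monic_modulus F n) c).coeff i

/-- The Hamming weight of `a_0 + a_1 x + ⋯ + a_{n-1} x^{n-1}`: the number of non-zero `a_i`. -/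
def weight (c : NegaRing F n) : ℕ := by
  classical exact hammingNorm (word F n c)

/-- The negacyclic shift: `f ↦ x f`. -/
def shift : NegaRing F n ≃ₗ[F] NegaRing F n :=
  DistribMulAction.toLinearEquiv F (NegaRing F n) (x F n)

/-- Multiplication by the scalar `ξ`. -/
def scalar (ξ : Fˣ) : NegaRing F n ≃ₗ[F] NegaRing F n :=
  DistribMulAction.toLinearEquiv F (NegaRing F n) ξ

/-- The ring endomorphism `x ↦ x^a`. -/
def multiplierHom (a : ℤ) (ha : IsCoprime a ((2 * n : ℕ) : ℤ)) :
    NegaRing F n →ₐ[F] NegaRing F n :=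
  AdjoinRoot.liftAlgHom _ (Algebra.ofId F (NegaRing F n)) (((x F n) ^ a : (NegaRing F n)ˣ)) (by
    have h : (((x F n) ^ a) ^ n : (NegaRing F n)ˣ) = -1 := by
      rw [← zpow_natCast, ← zpow_mul, mul_comm, zpow_mul, zpow_natCast, x_pow]
      exact (odd_of_isCoprime n ha).neg_one_zpow
    have h' := congrArg (fun u : (NegaRing F n)ˣ => (u : NegaRing F n)) h
    simp only [Units.val_pow_eq_pow_val, Units.val_neg, Units.val_one] at h'
    simp [h'])

lemma multiplierHom_x (a : ℤ) (ha : IsCoprime a ((2 * n : ℕ) : ℤ)) :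
    multiplierHom F n a ha (x F n) = ((x F n) ^ a : (NegaRing F n)ˣ) :=
  AdjoinRoot.liftAlgHom_root _ _ _ _

lemma multiplierHom_x_zpow (a : ℤ) (ha : IsCoprime a ((2 * n : ℕ) : ℤ)) (b : ℤ) :
    multiplierHom F n a ha ((x F n) ^ b : (NegaRing F n)ˣ) =
      ((x F n) ^ (a * b) : (NegaRing F n)ˣ) := by
  have h : Units.map (multiplierHom F n a ha : NegaRing F n →* NegaRing F n) (x F n) =
      (x F n) ^ a := Units.ext (multiplierHom_x F n a ha)
  have h2 := congrArg (fun u : (NegaRing F n)ˣ => ((u ^ b : (NegaRing F n)ˣ) : NegaRing F n)) h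
  simp only [← map_zpow, ← zpow_mul] at h2
  exact h2

lemma multiplierHom_bijective (a : ℤ) (ha : IsCoprime a ((2 * n : ℕ) : ℤ)) :
    Function.Bijective (multiplierHom F n a ha) := by
  have hfin : Module.Finite F (NegaRing F n) := (monic_modulus F n).finite_adjoinRoot
  have hs : Function.Surjective (multiplierHom F n a ha) := by
    obtain ⟨u, v, huv⟩ := ha
    have hx : ((x F n) ^ (a * u) : (NegaRing F n)ˣ) = x F n := by
      have h2n : (x F n) ^ ((2 * n : ℕ) : ℤ) = 1 := by
        rw [zpow_natCast, mul_comm, pow_mul, x_pow]; simp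
      have : a * u = 1 - ((2 * n : ℕ) : ℤ) * v := by linear_combination huv
      rw [this, zpow_sub, zpow_mul, h2n]; simp
    rw [← AlgHom.range_eq_top, eq_top_iff, ← AdjoinRoot.adjoinRoot_eq_top, Algebra.adjoin_le_iff,
      Set.singleton_subset_iff]
    refine ⟨((x F n) ^ u : (NegaRing F n)ˣ), ?_⟩
    have := multiplierHom_x_zpow F n a ⟨u, v, huv⟩ u
    rw [hx] at this
    exact this
  exact ⟨(LinearMap.injective_iff_surjective
    (f := (multiplierHom F n a ha).toLinearMap)).mpr hs, hs⟩

/-- The multiplier `μ_a : ∑ f_i x^i ↦ ∑ f_i x^{a i}`, for `a` coprime to `2 n`. -/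
def multiplier (a : ℤ) (ha : IsCoprime a ((2 * n : ℕ) : ℤ)) :
    NegaRing F n ≃ₗ[F] NegaRing F n :=
  LinearEquiv.ofBijective (multiplierHom F n a ha).toLinearMap (multiplierHom_bijective F n a ha)

theorem multiplier_sum (a : ℤ) (ha : IsCoprime a ((2 * n : ℕ) : ℤ)) (f : Fin n → F) :
    multiplier F n a ha (∑ i, f i • (((x F n) ^ (i : ℕ) : (NegaRing F n)ˣ) : NegaRing F n)) =
      ∑ i, f i • (((x F n) ^ (a * (i : ℕ)) : (NegaRing F n)ˣ) : NegaRing F n) := by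
  rw [map_sum]
  refine Finset.sum_congr rfl fun i _ => ?_
  rw [map_smul]
  congr 1
  have := multiplierHom_x_zpow F n a ha (i : ℕ)
  rw [zpow_natCast] at this
  exact this

/-- `μ_{-1}`. -/
def muNegOne : NegaRing F n ≃ₗ[F] NegaRing F n :=
  multiplier F n (-1) isCoprime_one_left.neg_left

/-- The number of orbits of `G` that meet `S`; when `S` is stable under `G`, this is the number of
`G`-orbits on `S`. -/
def orbitCount {F : Type*} [Field F] {n : ℕ} (G : Subgroup (NegaRing F n ≃ₗ[F] NegaRing F n))
    (S : Set (NegaRing F n)) : ℕ :=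
  {O : Set (NegaRing F n) | ∃ c ∈ S, O = MulAction.orbit G c}.ncard

end Basic

/-- The `q`-cyclotomic coset `{b, b q, b q², …}` modulo `N`. -/
def cyclotomicCoset (N q : ℕ) [NeZero N] (b : ZMod N) : Finset (ZMod N) := by
  classical exact Finset.univ.filter fun j => ∃ i : ℕ, j = b * (q : ZMod N) ^ i

section Card

lemma isCoprime_card (F : Type*) [Fintype F] (n : ℕ) (hq : Odd (Fintype.card F)) (hn : n.Coprime (Fintype.card F)) :
    IsCoprime ((Fintype.card F : ℕ) : ℤ) ((2 * n : ℕ) : ℤ) :=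
  Nat.isCoprime_iff_coprime.mpr (Nat.Coprime.mul_right hq.coprime_two_right hn.symm)

variable (F : Type*) [Field F] [Fintype F] (n : ℕ) [NeZero n]

/-- `μ_q`, where `q` is the cardinality of `F`. -/
def muQ (hq : Odd (Fintype.card F)) (hn : n.Coprime (Fintype.card F)) :
    NegaRing F n ≃ₗ[F] NegaRing F n :=
  multiplier F n (Fintype.card F : ℕ) (isCoprime_card F n hq hn)

/-- `⟨μ_q, ρ, σ_ξ⟩`. -/
def groupQ (hq : Odd (Fintype.card F)) (hn : n.Coprime (Fintype.card F)) (ξ : Fˣ) :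
    Subgroup (NegaRing F n ≃ₗ[F] NegaRing F n) :=
  Subgroup.closure {muQ F n hq hn, shift F n, scalar F n ξ}

/-- `⟨μ_{-1}, μ_q, ρ, σ_ξ⟩`. -/
def groupNegQ (hq : Odd (Fintype.card F)) (hn : n.Coprime (Fintype.card F)) (ξ : Fˣ) :
    Subgroup (NegaRing F n ≃ₗ[F] NegaRing F n) :=
  Subgroup.closure {muNegOne F n, muQ F n hq hn, shift F n, scalar F n ξ}

end Card

section Idempotent

/-- The primitive idempotent `e_j = (1/n) ∑_{l < n} ζ^{-j l} x^l` of `K[x] / ⟨x^n + 1⟩`. -/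
def splitIdempotent {K : Type*} [Field K] (n : ℕ) [NeZero n] (ζ : K) (j : ZMod (2 * n)) :
    NegaRing K n :=
  ∑ l ∈ Finset.range n,
    ((n : K)⁻¹ * ζ⁻¹ ^ (j.val * l)) • (((x K n) ^ l : (NegaRing K n)ˣ) : NegaRing K n)

variable (F : Type*) [Field F] [Fintype F] (n : ℕ) [NeZero n]

/-- The inclusion of `F[x] / ⟨x^n + 1⟩` in `K[x] / ⟨x^n + 1⟩`. -/
def baseChange (K : Type*) [Field K] [Algebra F K] : NegaRing F n →+* NegaRing K n :=
  AdjoinRoot.map (algebraMap F K) _ _ (by simp)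

lemma mem_range_of_pow_card {K : Type*} [Field K] [Algebra F K] {y : K}
    (hy : y ^ Fintype.card F = y) : ∃ a : F, algebraMap F K a = y := by
  have hm : (X ^ Fintype.card F - X : F[X]).Monic :=
    monic_X_pow_sub (by rw [degree_X]; exact_mod_cast Fintype.one_lt_card)
  have hr : (X ^ Fintype.card F - X : F[X]).roots = Finset.univ.val :=
    FiniteField.roots_X_pow_card_sub_X F
  have h := prod_multiset_X_sub_C_of_monic_of_roots_card_eq hm (by
    rw [hr, FiniteField.X_pow_card_sub_X_natDegree_eq F Fintype.one_lt_card]; rfl)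
  rw [hr] at h
  have h2 := congrArg (Polynomial.aeval y) h
  change aeval y (∏ a : F, (X - C a)) = _ at h2
  simp only [map_sub, map_pow, aeval_X, hy, sub_self, map_prod, aeval_C] at h2
  obtain ⟨a, -, ha⟩ := Finset.prod_eq_zero_iff.mp h2
  exact ⟨a, (sub_eq_zero.mp ha).symm⟩

variable {K : Type*} [Field K] [Algebra F K]

theorem exists_primitiveIdempotent (hq : Odd (Fintype.card F)) (hn : n.Coprime (Fintype.card F))
    {ζ : K} (hζ : IsPrimitiveRoot ζ (2 * n)) (b : ZMod (2 * n)) :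
    ∃ ε : NegaRing F n, baseChange F n K ε =
      ∑ j ∈ cyclotomicCoset (2 * n) (Fintype.card F) b, splitIdempotent n ζ j := by
  classical
  have hqu : IsUnit ((Fintype.card F : ℕ) : ZMod (2 * n)) :=
    (ZMod.isUnit_iff_coprime _ _).mpr (Nat.isCoprime_iff_coprime.mp (isCoprime_card F n hq hn))
  have hζ1 : ζ⁻¹ ^ (2 * n) = 1 := by rw [inv_pow, hζ.pow_eq_one, inv_one]
  -- multiplication by `q` permutes the coset
  have himg : (cyclotomicCoset (2 * n) (Fintype.card F) b).image
      (fun j => j * ((Fintype.card F : ℕ) : ZMod (2 * n))) =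
      cyclotomicCoset (2 * n) (Fintype.card F) b := by
    apply Finset.eq_of_subset_of_card_le
    · intro j hj
      obtain ⟨i, hi, rfl⟩ := Finset.mem_image.mp hj
      simp only [cyclotomicCoset, Finset.mem_filter, Finset.mem_univ, true_and] at hi ⊢
      obtain ⟨e, rfl⟩ := hi
      exact ⟨e + 1, by ring⟩
    · rw [Finset.card_image_of_injective _ hqu.mul_left_injective]
  have hc : ∀ l : ℕ, ∃ a : F, algebraMap F K a =
      ∑ j ∈ cyclotomicCoset (2 * n) (Fintype.card F) b, ((n : K)⁻¹ * ζ⁻¹ ^ (j.val * l)) := by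
    intro l
    apply mem_range_of_pow_card F
    change FiniteField.frobeniusAlgHom F K _ = _
    rw [map_sum]
    conv_rhs => rw [← himg, Finset.sum_image (fun _ _ _ _ h => hqu.mul_left_injective h)]
    refine Finset.sum_congr rfl fun j _ => ?_
    rw [map_mul, map_inv₀, map_natCast]
    congr 1
    change (ζ⁻¹ ^ (j.val * l)) ^ Fintype.card F = _
    rw [← pow_mul]
    apply pow_eq_pow_of_modEq _ hζ1
    have : (j * ((Fintype.card F : ℕ) : ZMod (2 * n))).val ≡ j.val * Fintype.card F [MOD 2 * n] := by
      rw [← ZMod.natCast_eq_natCast_iff]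
      simp
    calc j.val * l * Fintype.card F = j.val * Fintype.card F * l := by ring
      _ ≡ _ [MOD 2 * n] := (this.symm.mul_right l)
  choose a ha using hc
  refine ⟨∑ l ∈ Finset.range n, a l • (((x F n) ^ l : (NegaRing F n)ˣ) : NegaRing F n), ?_⟩
  simp only [splitIdempotent]
  rw [Finset.sum_comm, map_sum]
  refine Finset.sum_congr rfl fun l _ => ?_
  rw [← Finset.sum_smul, ← ha, Algebra.smul_def, Algebra.smul_def, map_mul]
  congr 1
  · exact AdjoinRoot.map_of _ _ _ _ _
  · simp only [Units.val_pow_eq_pow_val, map_pow]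
    congr 1
    exact AdjoinRoot.map_root _ _ _ _

/-- The primitive idempotent of `F[x] / ⟨x^n + 1⟩` corresponding to the cyclotomic coset of `b`:
the element that becomes the sum of the `e_j` over the coset after extension of scalars to `K`. -/
def primitiveIdempotent (hq : Odd (Fintype.card F)) (hn : n.Coprime (Fintype.card F))
    {ζ : K} (hζ : IsPrimitiveRoot ζ (2 * n)) (b : ZMod (2 * n)) : NegaRing F n :=
  (exists_primitiveIdempotent F n hq hn hζ b).choose

theorem baseChange_primitiveIdempotent (hq : Odd (Fintype.card F))
    (hn : n.Coprime (Fintype.card F))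
    {ζ : K} (hζ : IsPrimitiveRoot ζ (2 * n)) (b : ZMod (2 * n)) :
    baseChange F n K (primitiveIdempotent F n hq hn hζ b) =
      ∑ j ∈ cyclotomicCoset (2 * n) (Fintype.card F) b, splitIdempotent n ζ j :=
  (exists_primitiveIdempotent F n hq hn hζ b).choose_spec

/-- The irreducible negacyclic code generated by the primitive idempotent of the coset of `b`. -/
def irreducibleCode (hq : Odd (Fintype.card F)) (hn : n.Coprime (Fintype.card F))
    {ζ : K} (hζ : IsPrimitiveRoot ζ (2 * n)) (b : ZMod (2 * n)) : Submodule F (NegaRing F n) :=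
  (Ideal.span {primitiveIdempotent F n hq hn hζ b}).restrictScalars F

end Idempotent
end NegaRing
end

/-! ### Burnside's lemma for two commuting permutations -/

/-! Put β = ζ^(1+2a) and Q = q^k - 1. A word c of the code is determined by the pair (c(β), c(β⁻¹)),
and every pair in the square of the field 𝔽_{q^k} generated by β occurs. Indeed the values at the
conjugates of a root are Frobenius powers of one value, and the hypothesis on -(1+2a) says that β⁻¹
is not conjugate to β, so the two summands of the code do not interfere. In these coordinates μ_{-1}
exchanges the entries, μ_q raises both to the power q, the shift multiplies by (β, β⁻¹) and σ_ξ by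
(ξ, ξ). `exists_isPairCode` establishes this picture, and the orbit counts use nothing else about
the code.

Now take logarithms to the base of a generator θ of the cyclic group 𝔽_{q^k}^*. The elements β and ξ
generate the same subgroups as θ^M and θ^E, with M = (1+2a)Q/(2n) and E = Q/(q-1). The nonzero words
split into two axes (one entry zero) and a torus (no entry zero). Shifts and scalars become
translations, by gcd(E, M)ℤ on an axis and by the span of (M, -M) and (E, E) on the torus; adding
the periods (Q, 0) and (0, Q) gives the lattice `twistLattice`. Modulo these translations only two
commuting endomorphisms act, multiplication by q and, for the large group, the exchange of
coordinates.

Burnside's lemma applies to the quotient Z/Λ. The points fixed by an endomorphism g form the kernel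
of g - 1 on Z/Λ, whose size is the index of Λ + (g - 1)Z (`card_ker_quotient_map`). The gcds in the
formulas are these indices (`index_twistLattice`, `index_twistLattice_sup_swap_range`).

The small group counts both axes and the torus separately. In the large group μ_{-1} identifies the
two axes, which gives the single axis term in N and also the strict inequality. Every map in the
group is monomial, so the weight is constant on orbits; the bound and its equality case then say
when the weight separates orbits, made explicit by a normal form for the group elements. -/

lemma ZMod.sum_univ_eq_sum_range {M : Type*} [AddCommMonoid M] {m : ℕ} [NeZero m]
    (g : ZMod m → M) : ∑ x : ZMod m, g x = ∑ i ∈ Finset.range m, g (i : ZMod m) := by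
  refine (Finset.sum_nbij' (fun i : ℕ => (i : ZMod m)) ZMod.val ?_ ?_ ?_ ?_ ?_).symm
  · simp
  · intro x _; simpa using ZMod.val_lt x
  · intro i hi; exact ZMod.val_cast_of_lt (Finset.mem_range.mp hi)
  · intro x _; simp
  · simp

/-- The homomorphism from `ℤ/m` sending `1` to an element `F` with `F ^ m = 1`. -/
def zmodPowHom {G : Type*} [Group G] {m : ℕ} (F : G) (hF : F ^ m = 1) :
    Multiplicative (ZMod m) →* G :=
  AddMonoidHom.toMultiplicativeLeft (ZMod.lift m ⟨zmultiplesHom (Additive G) (Additive.ofMul F), by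
    simp [← ofMul_pow, hF]⟩)

lemma zmodPowHom_natCast {G : Type*} [Group G] {m : ℕ} (F : G) (hF : F ^ m = 1) (h : ℕ) :
    zmodPowHom F hF (Multiplicative.ofAdd (h : ZMod m)) = F ^ h := by
  have := ZMod.lift_coe m (⟨zmultiplesHom (Additive G) (Additive.ofMul F), by
    simp [← ofMul_pow, hF]⟩ : { f : ℤ →+ Additive G // f m = 0 }) (h : ℤ)
  simp only [Int.cast_natCast] at this
  simp only [zmodPowHom, AddMonoidHom.toMultiplicativeLeft, Equiv.coe_fn_mk]
  change Additive.toMul (ZMod.lift m _ (h : ZMod m)) = _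
  rw [this]
  simp [← ofMul_pow]

/-- Burnside's lemma for ℤ/2 × ℤ/m acting through S and F. The action need not be faithful: m may be
any nonzero multiple of the order of F, and S may be the identity. The orbits enter as the fibres of
`o`. -/
theorem burnside_two_commuting {Y α : Type*} [Finite Y] {m : ℕ} (hm : m ≠ 0)
    (F S : Equiv.Perm Y) (hF : F ^ m = 1) (hS : S ^ 2 = 1) (hc : Commute S F) (o : Y → α)
    (ho : ∀ y y', o y = o y' ↔ ∃ e h : ℕ, (S ^ e * F ^ h) y = y') :
    2 * m * (Set.range o).ncard =
      ∑ h ∈ Finset.range m,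
        (Nat.card {y // (F ^ h) y = y} + Nat.card {y // (S * F ^ h) y = y}) := by
  classical
  have : NeZero m := ⟨hm⟩
  have := Fintype.ofFinite Y
  let φ : Multiplicative (ZMod 2) × Multiplicative (ZMod m) →* Equiv.Perm Y :=
    MonoidHom.noncommCoprod (zmodPowHom S hS) (zmodPowHom F hF) (by
      intro a b
      obtain ⟨e, he⟩ := ZMod.natCast_zmod_surjective (Multiplicative.toAdd a)
      obtain ⟨h, hh⟩ := ZMod.natCast_zmod_surjective (Multiplicative.toAdd b)
      have ha : a = Multiplicative.ofAdd (e : ZMod 2) := by rw [he]; rfl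
      have hb : b = Multiplicative.ofAdd (h : ZMod m) := by rw [hh]; rfl
      rw [ha, hb, zmodPowHom_natCast, zmodPowHom_natCast]
      exact hc.pow_pow _ _)
  have hφ : ∀ e h : ℕ, φ (Multiplicative.ofAdd (e : ZMod 2), Multiplicative.ofAdd (h : ZMod m)) =
      S ^ e * F ^ h := by
    intro e h
    simp only [φ, MonoidHom.noncommCoprod_apply, zmodPowHom_natCast]
  let _act : MulAction (Multiplicative (ZMod 2) × Multiplicative (ZMod m)) Y :=
    MulAction.compHom Y φ
  have hact : ∀ ω (y : Y), ω • y = φ ω y := fun ω y => rfl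
  have hrel : ∀ y y' : Y, (MulAction.orbitRel (Multiplicative (ZMod 2) × Multiplicative (ZMod m)) Y) y y' ↔
      o y = o y' := by
    intro y y'
    rw [MulAction.orbitRel_apply, eq_comm, ho, MulAction.mem_orbit_iff]
    constructor
    · rintro ⟨⟨a, b⟩, h⟩
      obtain ⟨e, he⟩ := ZMod.natCast_zmod_surjective (Multiplicative.toAdd a)
      obtain ⟨h', hh⟩ := ZMod.natCast_zmod_surjective (Multiplicative.toAdd b)
      have ha : a = Multiplicative.ofAdd (e : ZMod 2) := by rw [he]; rfl
      have hb : b = Multiplicative.ofAdd (h' : ZMod m) := by rw [hh]; rfl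
      refine ⟨e, h', ?_⟩
      rw [← hφ, ← ha, ← hb]; exact h
    · rintro ⟨e, h, hh⟩
      exact ⟨(Multiplicative.ofAdd (e : ZMod 2), Multiplicative.ofAdd (h : ZMod m)), by
        rw [hact, hφ]; exact hh⟩
  have hcard : (Set.range o).ncard = Nat.card (MulAction.orbitRel.Quotient
      (Multiplicative (ZMod 2) × Multiplicative (ZMod m)) Y) := by
    rw [← Nat.card_coe_set_eq]
    refine Nat.card_congr (Equiv.symm (Equiv.ofBijective
      (Quotient.lift (fun y => (⟨o y, y, rfl⟩ : Set.range o))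
        (fun y y' h => Subtype.ext ((hrel y y').mp h))) ⟨?_, ?_⟩))
    · rintro ⟨y⟩ ⟨y'⟩ h
      exact Quotient.sound ((hrel y y').mpr (congrArg Subtype.val h))
    · rintro ⟨_, y, rfl⟩
      exact ⟨Quotient.mk _ y, rfl⟩
  have hb := MulAction.sum_card_fixedBy_eq_card_orbits_mul_card_group
    (Multiplicative (ZMod 2) × Multiplicative (ZMod m)) Y
  rw [hcard]
  have hcardG : Fintype.card (Multiplicative (ZMod 2) × Multiplicative (ZMod m)) = 2 * m := by
    rw [Fintype.card_prod, Fintype.card_multiplicative, Fintype.card_multiplicative, ZMod.card,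
      ZMod.card]
  rw [hcardG, ← Nat.card_eq_fintype_card] at hb
  rw [mul_comm, ← hb, Fintype.sum_prod_type,
    ← Equiv.sum_comp (Multiplicative.ofAdd (α := ZMod 2)), ZMod.sum_univ_eq_sum_range]
  simp only [← Equiv.sum_comp (Multiplicative.ofAdd (α := ZMod m)), ZMod.sum_univ_eq_sum_range]
  rw [Finset.sum_range_succ, Finset.sum_range_one, ← Finset.sum_add_distrib]
  refine Finset.sum_congr rfl fun h _ => ?_
  congr 1
  · rw [← Nat.card_eq_fintype_card]
    refine Nat.card_congr (Equiv.subtypeEquivRight fun y => ?_)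
    rw [MulAction.mem_fixedBy, hact, hφ, pow_zero, one_mul]
  · rw [← Nat.card_eq_fintype_card]
    refine Nat.card_congr (Equiv.subtypeEquivRight fun y => ?_)
    rw [MulAction.mem_fixedBy, hact, hφ, pow_one]

/-! ### Counting classes of a finite quotient of an abelian group -/

lemma card_ker_eq_index_range {Y : Type*} [AddCommGroup Y] [Finite Y] (g : Y →+ Y) :
    Nat.card g.ker = g.range.index := by
  have h1 := g.ker.card_mul_index
  have h2 := g.range.card_mul_index
  rw [AddSubgroup.index_ker] at h1
  have : 0 < Nat.card g.range := Nat.card_pos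
  nlinarith

/-- On a finite group the kernel is as large as the index of the range, and the range of the induced
map pulls back to Λ + g(Z). This moves the count of fixed points from the quotient to an index in Z.
-/
lemma card_ker_quotient_map {Z : Type*} [AddCommGroup Z] (Λ : AddSubgroup Z) [Finite (Z ⧸ Λ)]
    (g : Z →+ Z) (hg : Λ ≤ Λ.comap g) :
    Nat.card (QuotientAddGroup.map Λ Λ g hg).ker = (Λ ⊔ g.range).index := by
  rw [card_ker_eq_index_range]
  have h1 : (QuotientAddGroup.map Λ Λ g hg).range = g.range.map (QuotientAddGroup.mk' Λ) := by
    ext y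
    constructor
    · rintro ⟨x, rfl⟩
      obtain ⟨z, rfl⟩ := QuotientAddGroup.mk_surjective x
      exact ⟨g z, ⟨z, rfl⟩, rfl⟩
    · rintro ⟨_, ⟨z, rfl⟩, rfl⟩
      exact ⟨(z : Z ⧸ Λ), rfl⟩
  rw [h1, ← AddSubgroup.index_comap_of_surjective _ (QuotientAddGroup.mk'_surjective Λ),
    AddSubgroup.comap_map_eq, QuotientAddGroup.ker_mk', sup_comm]

/-- Both f and s descend to Z/Λ, where they are invertible because they have finite order. A point
is fixed by g exactly when it lies in the kernel of g - 1, so each Burnside term is a lattice index.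
-/
theorem two_mul_card_classes {Z α : Type*} [AddCommGroup Z] (Λ : AddSubgroup Z)
    (hΛ : Λ.index ≠ 0) (f s : AddMonoid.End Z) {m : ℕ} (hm : m ≠ 0)
    (hfΛ : ∀ z ∈ Λ, f z ∈ Λ) (hsΛ : ∀ z ∈ Λ, s z ∈ Λ) (hfm : ∀ z, (f ^ m) z - z ∈ Λ)
    (hs2 : s ^ 2 = 1) (hc : Commute s f) (o : Z → α)
    (ho : ∀ z z', o z = o z' ↔ ∃ e h : ℕ, (s ^ e * f ^ h) z - z' ∈ Λ) :
    2 * m * (Set.range o).ncard =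
      ∑ h ∈ Finset.range m,
        ((Λ ⊔ AddMonoidHom.range (f ^ h - 1 : AddMonoid.End Z)).index +
          (Λ ⊔ AddMonoidHom.range (s * f ^ h - 1 : AddMonoid.End Z)).index) := by
  have : Finite (Z ⧸ Λ) := Nat.finite_of_card_ne_zero hΛ
  let red (g : AddMonoid.End Z) (hg : ∀ z ∈ Λ, g z ∈ Λ) : AddMonoid.End (Z ⧸ Λ) :=
    QuotientAddGroup.map Λ Λ g hg
  let f' := red f hfΛ
  let s' := red s hsΛ
  have hfp : ∀ (h : ℕ) (z : Z), (f' ^ h) (z : Z ⧸ Λ) = ((f ^ h) z : Z) := by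
    intro h
    induction h with
    | zero => intro z; rfl
    | succ h ih => intro z; rw [pow_succ, pow_succ]; exact ih (f z)
  have hsp : ∀ (h : ℕ) (z : Z), (s' ^ h) (z : Z ⧸ Λ) = ((s ^ h) z : Z) := by
    intro h
    induction h with
    | zero => intro z; rfl
    | succ h ih => intro z; rw [pow_succ, pow_succ]; exact ih (s z)
  have hfm' : f' ^ m = 1 := by
    ext y
    obtain ⟨z, rfl⟩ := QuotientAddGroup.mk_surjective y
    rw [hfp]
    exact (QuotientAddGroup.eq_iff_sub_mem).mpr (hfm z)
  have hs2' : s' ^ 2 = 1 := by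
    ext y
    obtain ⟨z, rfl⟩ := QuotientAddGroup.mk_surjective y
    rw [hsp, hs2]; rfl
  have hc' : Commute s' f' := by
    ext y
    obtain ⟨z, rfl⟩ := QuotientAddGroup.mk_surjective y
    exact congrArg (fun z : Z => (z : Z ⧸ Λ)) (DFunLike.congr_fun hc z)
  let toPerm : (AddMonoid.End (Z ⧸ Λ))ˣ →* Equiv.Perm (Z ⧸ Λ) :=
    MulAction.toPermHom _ _
  let Fu := Units.ofPowEqOne f' m hfm' hm
  let Su := Units.ofPowEqOne s' 2 hs2' two_ne_zero
  have hFS : ∀ (e h : ℕ) (z : Z), (toPerm Su ^ e * toPerm Fu ^ h) (z : Z ⧸ Λ) =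
      ((s ^ e * f ^ h) z : Z) := by
    intro e h z
    rw [← map_pow, ← map_pow, ← map_mul]
    change ((Su ^ e * Fu ^ h : (AddMonoid.End (Z ⧸ Λ))ˣ) : AddMonoid.End (Z ⧸ Λ)) (z : Z ⧸ Λ) = _
    rw [Units.val_mul, Units.val_pow_eq_pow_val, Units.val_pow_eq_pow_val]
    change (s' ^ e) ((f' ^ h) (z : Z ⧸ Λ)) = _
    rw [hfp, hsp]; rfl
  have hoΛ : ∀ z z' : Z, z - z' ∈ Λ → o z = o z' := fun z z' h => (ho z z').mpr ⟨0, 0, by simpa using h⟩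
  let o' : Z ⧸ Λ → α := Quotient.lift o (fun z z' h => hoΛ z z' (by
    rw [← QuotientAddGroup.eq_iff_sub_mem]; exact Quotient.sound h))
  have ho' : Set.range o' = Set.range o := by
    ext y; constructor
    · rintro ⟨⟨z⟩, rfl⟩; exact ⟨z, rfl⟩
    · rintro ⟨z, rfl⟩; exact ⟨(z : Z ⧸ Λ), rfl⟩
  have hfix : ∀ (g : AddMonoid.End Z) (_ : ∀ z ∈ Λ, g z ∈ Λ) (P : Equiv.Perm (Z ⧸ Λ)),
      (∀ z : Z, P (z : Z ⧸ Λ) = (g z : Z)) →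
      Nat.card {y // P y = y} = (Λ ⊔ AddMonoidHom.range (g - 1 : AddMonoid.End Z)).index := by
    intro g hg P hP
    rw [← card_ker_quotient_map Λ (g - 1 : AddMonoid.End Z) (fun z hz => Λ.sub_mem (hg z hz) hz)]
    refine Nat.card_congr (Equiv.subtypeEquivRight fun y => ?_)
    obtain ⟨z, rfl⟩ := QuotientAddGroup.mk_surjective y
    rw [AddMonoidHom.mem_ker, hP, ← sub_eq_zero, ← QuotientAddGroup.mk_sub]
    exact Iff.rfl
  have hfpΛ : ∀ h : ℕ, ∀ z ∈ Λ, (f ^ h) z ∈ Λ := by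
    intro h
    induction h with
    | zero => intro z hz; exact hz
    | succ h ih => intro z hz; rw [pow_succ]; exact ih _ (hfΛ z hz)
  have hb := burnside_two_commuting hm (toPerm Fu) (toPerm Su)
    (by rw [← map_pow, Units.ext (by rw [Units.val_pow_eq_pow_val]; exact hfm' : ((Fu ^ m :
      (AddMonoid.End (Z ⧸ Λ))ˣ) : AddMonoid.End (Z ⧸ Λ)) = (1 : (AddMonoid.End (Z ⧸ Λ))ˣ)), map_one])
    (by rw [← map_pow, Units.ext (by rw [Units.val_pow_eq_pow_val]; exact hs2' : ((Su ^ 2 :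
      (AddMonoid.End (Z ⧸ Λ))ˣ) : AddMonoid.End (Z ⧸ Λ)) = (1 : (AddMonoid.End (Z ⧸ Λ))ˣ)), map_one])
    ((show Commute Su Fu from Units.ext hc').map toPerm) o' (by
      rintro ⟨z⟩ ⟨z'⟩
      change o z = o z' ↔ _
      rw [ho]
      refine exists_congr fun e => exists_congr fun h => ?_
      change _ ↔ (toPerm Su ^ e * toPerm Fu ^ h) (z : Z ⧸ Λ) = (z' : Z ⧸ Λ)
      rw [hFS, QuotientAddGroup.eq_iff_sub_mem])
  rw [ho'] at hb
  rw [hb]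
  refine Finset.sum_congr rfl fun h _ => ?_
  rw [hfix (f ^ h) (hfpΛ h), hfix (s * f ^ h) (fun z hz => hsΛ _ (hfpΛ h z hz))]
  · intro z; simpa using hFS 1 h z
  · intro z; simpa using hFS 0 h z

/-! ### Indices of lattices in `ℤ × ℤ` -/

/-- The index is multiplicative along the projection A × B → A: one factor comes from the image, the
other from the fibre over 0. -/
lemma AddSubgroup.index_prod_eq {A B : Type*} [AddCommGroup A] [AddCommGroup B]
    (Λ : AddSubgroup (A × B)) :
    Λ.index = (Λ.map (AddMonoidHom.fst A B)).index * (Λ.comap (AddMonoidHom.inr A B)).index := by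
  have hk : (AddMonoidHom.fst A B).ker = (AddMonoidHom.inr A B).range := by
    ext ⟨a, b⟩
    simp only [AddMonoidHom.mem_ker, AddMonoidHom.coe_fst, AddMonoidHom.mem_range,
      AddMonoidHom.inr_apply, Prod.mk.injEq]
    exact ⟨fun h => ⟨b, h.symm, rfl⟩, fun ⟨_, h, _⟩ => h.symm⟩
  rw [← AddSubgroup.index_comap_of_surjective (Λ.map (AddMonoidHom.fst A B))
      (f := AddMonoidHom.fst A B) (Prod.fst_surjective),
    AddSubgroup.comap_map_eq, hk, AddSubgroup.index_comap,
    ← AddSubgroup.relIndex_sup_right (AddMonoidHom.inr A B).range Λ, sup_comm _ Λ, mul_comm,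
    AddSubgroup.relIndex_mul_index le_sup_left]

lemma Int.index_eq_of_mem_iff_dvd (H : AddSubgroup ℤ) (d : ℕ) (h : ∀ x, x ∈ H ↔ (d : ℤ) ∣ x) :
    H.index = d := by
  have : H = AddSubgroup.zmultiples (d : ℤ) := by
    ext x; rw [h, Int.mem_zmultiples_iff]
  rw [this, Int.index_zmultiples, Int.natAbs_natCast]

lemma Int.gcd_dvd_iff_exists (a b x : ℤ) :
    ((Int.gcd a b : ℕ) : ℤ) ∣ x ↔ ∃ u v : ℤ, x = u * a + v * b := by
  constructor
  · rintro ⟨c, rfl⟩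
    exact ⟨c * Int.gcdA a b, c * Int.gcdB a b, by rw [Int.gcd_eq_gcd_ab]; ring⟩
  · rintro ⟨u, v, rfl⟩
    exact dvd_add (Dvd.dvd.mul_left (Int.gcd_dvd_left ..) _) (Dvd.dvd.mul_left (Int.gcd_dvd_right ..) _)

/-- The lattice spanned by `(t, 0)`, `(0, t)`, `(M, -M)` and `(E, E)`. -/
def twistLattice (t M E : ℤ) : AddSubgroup (ℤ × ℤ) where
  carrier := {z | ∃ a b c d : ℤ, z = (a * t + c * M + d * E, b * t - c * M + d * E)}
  zero_mem' := ⟨0, 0, 0, 0, by ext <;> simp⟩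
  add_mem' := by
    rintro _ _ ⟨a, b, c, d, rfl⟩ ⟨a', b', c', d', rfl⟩
    exact ⟨a + a', b + b', c + c', d + d', by ext <;> simp <;> ring⟩
  neg_mem' := by
    rintro _ ⟨a, b, c, d, rfl⟩
    exact ⟨-a, -b, -c, -d, by ext <;> simp <;> ring⟩

lemma mem_twistLattice {t M E : ℤ} {z : ℤ × ℤ} : z ∈ twistLattice t M E ↔
    ∃ a b c d : ℤ, z = (a * t + c * M + d * E, b * t - c * M + d * E) := Iff.rfl

/-- The first coordinates fill δℤ with δ = gcd(t, M, E). In the fibre over 0, with g = gcd(M, t),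
the coefficient of (E, E) must be a multiple of g/δ, and adding the two coordinates cancels M, so
the fibre is generated by t and 2E·g/δ. The index is the product of δ and gcd(t, 2E·g/δ). -/
lemma index_twistLattice (t M E : ℕ) (ht : t ≠ 0) :
    (twistLattice t M E).index = Nat.gcd (t * Nat.gcd t (Nat.gcd E M)) (2 * (M * E)) := by
  set g := Nat.gcd M t with hg
  set δ := Nat.gcd g E with hδ
  have hg0 : 0 < g := Nat.gcd_pos_of_pos_right _ (Nat.pos_of_ne_zero ht)
  have hδ0 : 0 < δ := Nat.gcd_pos_of_pos_left _ hg0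
  obtain ⟨g', hg'⟩ : δ ∣ g := Nat.gcd_dvd_left _ _
  obtain ⟨E', hE'⟩ : δ ∣ E := Nat.gcd_dvd_right _ _
  have hcop : Nat.Coprime g' E' := by
    have := Nat.gcd_mul_left δ g' E'
    rw [← hg', ← hE', ← hδ] at this
    exact Nat.eq_of_mul_eq_mul_left hδ0 (by rw [mul_one]; exact this.symm)
  have hgI : ((g : ℕ) : ℤ) = δ * g' := by exact_mod_cast hg'
  have hEI : ((E : ℕ) : ℤ) = δ * E' := by exact_mod_cast hE'
  have hδI : (δ : ℤ) ≠ 0 := by exact_mod_cast hδ0.ne'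
  obtain ⟨x, y, hxy⟩ : ∃ x y : ℤ, (g : ℤ) = x * M + y * t :=
    (Int.gcd_dvd_iff_exists M t g).mp (by rw [Int.gcd_natCast_natCast])
  obtain ⟨Mg, hMg⟩ : (g : ℤ) ∣ M := by exact_mod_cast Nat.gcd_dvd_left M t
  obtain ⟨tg, htg⟩ : (g : ℤ) ∣ t := by exact_mod_cast Nat.gcd_dvd_right M t
  obtain ⟨p, r, hpr⟩ : ∃ p r : ℤ, (δ : ℤ) = p * g + r * E :=
    (Int.gcd_dvd_iff_exists g E δ).mp (by rw [Int.gcd_natCast_natCast])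
  have h1 : ((twistLattice t M E).map (AddMonoidHom.fst ℤ ℤ)).index = δ := by
    apply Int.index_eq_of_mem_iff_dvd
    intro w
    constructor
    · rintro ⟨_, ⟨a, b, c, d, rfl⟩, rfl⟩
      refine ⟨a * (g' * tg) + c * (g' * Mg) + d * E', ?_⟩
      change a * (t : ℤ) + c * M + d * E = _
      rw [htg, hMg, hgI, hEI]; ring
    · rintro ⟨w', rfl⟩
      refine ⟨_, ⟨w' * p * y, 0, w' * p * x, w' * r, rfl⟩, ?_⟩
      change w' * p * y * (t : ℤ) + w' * p * x * M + w' * r * E = _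
      rw [hpr, hxy]; ring
  have h2 : ((twistLattice t M E).comap (AddMonoidHom.inr ℤ ℤ)).index = Nat.gcd t (2 * E * g') := by
    apply Int.index_eq_of_mem_iff_dvd
    intro w
    rw [← Int.gcd_natCast_natCast, Int.gcd_dvd_iff_exists, AddSubgroup.mem_comap,
      AddMonoidHom.inr_apply, mem_twistLattice]
    constructor
    · rintro ⟨a, b, c, d, h⟩
      obtain ⟨ha, hb⟩ := Prod.mk.inj h
      -- The vanishing first coordinate a·t + c·M + d·E forces g to divide d·E; dividing by δ leaves
      -- g' ∣ d·E' with g' and E' coprime.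
      have hd : (g' : ℤ) ∣ d * E' := by
        refine ⟨-(c * Mg + a * tg), ?_⟩
        apply mul_left_cancel₀ hδI
        rw [htg, hMg, hEI, hgI] at ha
        linear_combination -ha
      obtain ⟨d', rfl⟩ := (Int.isCoprime_iff_gcd_eq_one.mpr (by
        rw [Int.gcd_natCast_natCast]; exact hcop) : IsCoprime (g' : ℤ) E').dvd_of_dvd_mul_right hd
      refine ⟨a + b, d', ?_⟩
      push_cast
      linear_combination hb + ha
    · rintro ⟨u, v, rfl⟩
      -- The Bézout relation g = x·M + y·t cancels v·g'·E = v·E'·g in the first coordinate, and the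
      -- same relation doubles it in the second.
      refine ⟨-y * (v * E'), u + v * y * E', -x * (v * E'), v * g', ?_⟩
      have hE2 : (g : ℤ) * E' = g' * E := by rw [hgI, hEI]; ring
      push_cast
      ext
      · simp only
        linear_combination -v * E' * hxy + v * hE2
      · simp only
        linear_combination v * E' * hxy - v * hE2
  rw [AddSubgroup.index_prod_eq, h1, h2, ← Nat.gcd_mul_left]
  have e1 : Nat.gcd t (Nat.gcd E M) = δ := by
    rw [hδ, hg, Nat.gcd_comm M t, Nat.gcd_comm E M, Nat.gcd_assoc]
  rw [e1]
  have e2 : δ * (2 * E * g') = Nat.gcd (2 * (M * E)) (t * (2 * E)) := by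
    rw [show 2 * (M * E) = M * (2 * E) by ring, Nat.gcd_mul_right, ← hg, hg']; ring
  rw [e2, ← Nat.gcd_assoc, mul_comm δ t]
  -- The product of the two indices is gcd(tδ, 2ME, 2tE); the last entry is redundant because δ
  -- divides E.
  apply Nat.gcd_eq_left
  exact (Nat.gcd_dvd_left _ _).trans (Nat.mul_dvd_mul_left t
    ((Nat.gcd_dvd_right g E).trans (Dvd.intro_left _ rfl)))

/-- The endomorphism `z ↦ q z`. -/
def mulEnd (Z : Type*) [AddCommGroup Z] (q : ℕ) : AddMonoid.End Z := (q : AddMonoid.End Z)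

lemma mulEnd_pow_apply {Z : Type*} [AddCommGroup Z] (q h : ℕ) (z : Z) :
    (mulEnd Z q ^ h) z = (q ^ h : ℕ) • z := by
  rw [mulEnd, ← Nat.cast_pow, AddMonoid.End.natCast_apply]

/-- The exchange of the two coordinates. -/
def swapEnd : AddMonoid.End (ℤ × ℤ) := (AddEquiv.prodComm : ℤ × ℤ ≃+ ℤ × ℤ).toAddMonoidHom

lemma swapEnd_apply (z : ℤ × ℤ) : swapEnd z = (z.2, z.1) := rfl

lemma index_zmultiples_sup_range (D q h : ℕ) (hq : 0 < q) :
    (AddSubgroup.zmultiples (D : ℤ) ⊔ AddMonoidHom.range (mulEnd ℤ q ^ h - 1 : AddMonoid.End ℤ)).index =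
      Nat.gcd D (q ^ h - 1) := by
  apply Int.index_eq_of_mem_iff_dvd
  intro x
  rw [← Int.gcd_natCast_natCast, Int.gcd_dvd_iff_exists, AddSubgroup.mem_sup]
  have e : ((q ^ h - 1 : ℕ) : ℤ) = (q : ℤ) ^ h - 1 := by
    rw [Nat.cast_sub (Nat.one_le_pow _ _ hq)]; push_cast; ring
  constructor
  · rintro ⟨_, ⟨u, rfl⟩, _, ⟨v, rfl⟩, rfl⟩
    refine ⟨u, v, ?_⟩
    rw [e]
    change u • (D : ℤ) + ((mulEnd ℤ q ^ h) v - v) = _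
    rw [mulEnd_pow_apply]; simp; ring
  · rintro ⟨u, v, rfl⟩
    refine ⟨_, ⟨u, rfl⟩, _, ⟨v, rfl⟩, ?_⟩
    rw [e]
    change u • (D : ℤ) + ((mulEnd ℤ q ^ h) v - v) = _
    rw [mulEnd_pow_apply]; simp; ring

lemma twistLattice_sup_range (Q M E q h : ℕ) (hq : 0 < q) :
    twistLattice Q M E ⊔ AddMonoidHom.range (mulEnd (ℤ × ℤ) q ^ h - 1 : AddMonoid.End (ℤ × ℤ)) =
      twistLattice (Nat.gcd Q (q ^ h - 1) : ℕ) M E := by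
  have e : ((q ^ h - 1 : ℕ) : ℤ) = (q : ℤ) ^ h - 1 := by
    rw [Nat.cast_sub (Nat.one_le_pow _ _ hq)]; push_cast; ring
  have hr : ∀ w, w ∈ AddMonoidHom.range (mulEnd (ℤ × ℤ) q ^ h - 1 : AddMonoid.End (ℤ × ℤ)) ↔
      ∃ v : ℤ × ℤ, w = (((q : ℤ) ^ h - 1) * v.1, ((q : ℤ) ^ h - 1) * v.2) := by
    refine fun w => exists_congr fun v => eq_comm.trans (Eq.congr_right ?_)
    change (mulEnd (ℤ × ℤ) q ^ h) v - v = _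
    rw [mulEnd_pow_apply]
    ext <;> simp <;> ring
  ext z
  rw [AddSubgroup.mem_sup, mem_twistLattice]
  constructor
  · rintro ⟨_, ⟨a, b, c, d, rfl⟩, _, hv, rfl⟩
    obtain ⟨v, rfl⟩ := (hr _).mp hv
    obtain ⟨a', ha'⟩ := (Int.gcd_dvd_iff_exists Q (q ^ h - 1 : ℕ) (a * Q + v.1 * (q ^ h - 1 : ℕ))).mpr
      ⟨a, v.1, rfl⟩
    obtain ⟨b', hb'⟩ := (Int.gcd_dvd_iff_exists Q (q ^ h - 1 : ℕ) (b * Q + v.2 * (q ^ h - 1 : ℕ))).mpr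
      ⟨b, v.2, rfl⟩
    refine ⟨a', b', c, d, ?_⟩
    rw [Int.gcd_natCast_natCast, e] at ha' hb'
    ext
    · simp only [Prod.fst_add]; linear_combination ha'
    · simp only [Prod.snd_add]; linear_combination hb'
  · rintro ⟨a, b, c, d, rfl⟩
    obtain ⟨u, v, huv⟩ := (Int.gcd_dvd_iff_exists Q (q ^ h - 1 : ℕ) (Nat.gcd Q (q ^ h - 1) : ℕ)).mp
      (by rw [Int.gcd_natCast_natCast])
    refine ⟨_, ⟨a * u, b * u, c, d, rfl⟩, _, (hr _).mpr ⟨(a * v, b * v), rfl⟩, ?_⟩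
    rw [e] at huv
    ext
    · simp only [Prod.fst_add]; linear_combination -a * huv
    · simp only [Prod.snd_add]; linear_combination -b * huv

/-- The range contains all (w, -q^h w), so the projection to the first coordinate is onto and every
vector (u, v) is congruent to (0, v + q^h u). The functional (u, v) ↦ v + q^h u sends the generators
of the lattice to q^h Q, Q, (q^h - 1)M up to sign and (q^h + 1)E, and the range to the multiples of
q^(2h) - 1. The index is the gcd of these. -/
lemma index_twistLattice_sup_swap_range (Q M E q h : ℕ) (hq : 0 < q) :
    (twistLattice Q M E ⊔
      AddMonoidHom.range (swapEnd * mulEnd (ℤ × ℤ) q ^ h - 1 : AddMonoid.End (ℤ × ℤ))).index =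
      Nat.gcd (Nat.gcd Q (q ^ (2 * h) - 1)) (Nat.gcd ((q ^ h + 1) * E) ((q ^ h - 1) * M)) := by
  have e : ∀ h : ℕ, ((q ^ h - 1 : ℕ) : ℤ) = (q : ℤ) ^ h - 1 := by
    intro h; rw [Nat.cast_sub (Nat.one_le_pow _ _ hq)]; push_cast; ring
  have hr : ∀ w,
      w ∈ AddMonoidHom.range (swapEnd * mulEnd (ℤ × ℤ) q ^ h - 1 : AddMonoid.End (ℤ × ℤ)) ↔
      ∃ v : ℤ × ℤ, w = ((q : ℤ) ^ h * v.2 - v.1, (q : ℤ) ^ h * v.1 - v.2) := by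
    refine fun w => exists_congr fun v => eq_comm.trans (Eq.congr_right ?_)
    change swapEnd ((mulEnd (ℤ × ℤ) q ^ h) v) - v = _
    rw [mulEnd_pow_apply, swapEnd_apply]
    ext <;> simp
  rw [AddSubgroup.index_prod_eq, Int.index_eq_of_mem_iff_dvd _ 1, one_mul,
    Int.index_eq_of_mem_iff_dvd]
  · intro w
    rw [AddSubgroup.mem_comap, AddMonoidHom.inr_apply, AddSubgroup.mem_sup]
    rw [← Int.gcd_natCast_natCast, Int.gcd_dvd_iff_exists]
    constructor
    · rintro ⟨_, ⟨a, b, c, d, rfl⟩, _, hv, hz⟩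
      obtain ⟨v, rfl⟩ := (hr _).mp hv
      obtain ⟨h1, h2⟩ := Prod.mk.inj hz
      obtain ⟨x1, hx1⟩ := (Int.gcd_dvd_iff_exists Q (q ^ (2 * h) - 1 : ℕ)
        ((b + q ^ h * a) * Q + v.2 * (q ^ (2 * h) - 1 : ℕ))).mpr ⟨_, _, rfl⟩
      obtain ⟨x2, hx2⟩ := (Int.gcd_dvd_iff_exists ((q ^ h + 1) * E : ℕ) ((q ^ h - 1) * M : ℕ)
        (d * ((q ^ h + 1) * E : ℕ) + c * ((q ^ h - 1) * M : ℕ))).mpr ⟨_, _, rfl⟩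
      refine ⟨x1, x2, ?_⟩
      rw [Int.gcd_natCast_natCast] at hx1 hx2
      rw [mul_comm x1, mul_comm x2, ← hx1, ← hx2]
      push_cast [e]
      rw [pow_mul']
      linear_combination -h2 - (q : ℤ) ^ h * h1
    · rintro ⟨u, v, rfl⟩
      obtain ⟨x1, y1, h1⟩ := (Int.gcd_dvd_iff_exists Q (q ^ (2 * h) - 1 : ℕ)
        (Nat.gcd Q (q ^ (2 * h) - 1) : ℕ)).mp (by rw [Int.gcd_natCast_natCast])
      obtain ⟨x2, y2, h2⟩ := (Int.gcd_dvd_iff_exists ((q ^ h + 1) * E : ℕ) ((q ^ h - 1) * M : ℕ)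
        (Nat.gcd ((q ^ h + 1) * E) ((q ^ h - 1) * M) : ℕ)).mp (by rw [Int.gcd_natCast_natCast])
      -- The first entry of the vector fed to the range is chosen so that the first coordinates
      -- cancel; the second coordinates then assemble the two Bézout relations.
      refine ⟨_, ⟨0, u * x1, v * y2, v * x2, rfl⟩, _,
        (hr _).mpr ⟨(v * y2 * M + v * x2 * E + q ^ h * (u * y1), u * y1), rfl⟩, ?_⟩
      rw [h1, h2]
      push_cast [e]
      rw [pow_mul']
      ext
      · simp only [Prod.fst_add]; ring
      · simp only [Prod.snd_add]; ring
  · intro w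
    simp only [Nat.cast_one, one_dvd, iff_true]
    refine ⟨(w, -(q : ℤ) ^ h * w), AddSubgroup.mem_sup_right ((hr _).mpr ⟨(-w, 0), ?_⟩), rfl⟩
    ext <;> simp

/-- Exactly φ(k/d) of the h below k satisfy gcd(k, h) = d. This turns a Burnside sum over Frobenius
powers into the divisor sums of the statement. -/
lemma sum_range_gcd_eq_sum_divisors {R : Type*} [CommSemiring R] (k : ℕ) (hk : k ≠ 0)
    (F : ℕ → R) :
    ∑ h ∈ Finset.range k, F (Nat.gcd k h) = ∑ h ∈ k.divisors, (Nat.totient (k / h) : R) * F h := by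
  rw [← Finset.sum_fiberwise_of_maps_to (s := Finset.range k) (t := k.divisors) (g := Nat.gcd k)
    (fun h _ => Nat.mem_divisors.mpr ⟨Nat.gcd_dvd_left k h, hk⟩)]
  refine Finset.sum_congr rfl fun d hd => ?_
  rw [Nat.totient_div_of_dvd (Nat.dvd_of_mem_divisors hd),
    Finset.sum_congr rfl (fun x hx => by rw [(Finset.mem_filter.mp hx).2] :
      ∀ x ∈ {x ∈ Finset.range k | Nat.gcd k x = d}, F (Nat.gcd k x) = F d), Finset.sum_const,
    nsmul_eq_mul]

/-! ### Normal forms in a metacyclic-type group -/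

section NormalForm

variable {G : Type*} [Group G] {s f r c : G}

lemma SemiconjBy.exists_zpow_comm_pow {x y : G} {w : ℕ}
    (h : ∀ z : ℤ, ∃ z' : ℤ, x ^ z * y = y * x ^ z') : ∀ z : ℤ, ∃ z' : ℤ, x ^ z * y ^ w = y ^ w * x ^ z' := by
  induction w with
  | zero => intro z; exact ⟨z, by simp⟩
  | succ w ih =>
    intro z
    obtain ⟨z₁, h₁⟩ := ih z
    obtain ⟨z₂, h₂⟩ := h z₁
    exact ⟨z₂, by rw [pow_succ, ← mul_assoc, h₁, mul_assoc, h₂, mul_assoc]⟩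

/-- The cyclic group of r is normalised by s and f, and c is central, so a generator multiplied on
the left of a word s·f·r·c can be moved to its place. The relation r^n = c^p then brings the
exponent of r below n at the expense of c. -/
theorem exists_normalForm_of_mem_closure {q n m p N : ℕ} (hn : n ≠ 0) (hm : m ≠ 0) (hN : N ≠ 0)
    (hs : s ^ 2 = 1) (hf : f ^ m = 1) (hsf : s * f = f * s) (hcs : Commute c s)
    (hcf : Commute c f) (hcr : Commute c r) (hrn : r ^ n = c ^ p) (hcN : c ^ N = 1)
    (hsr : s * r = r⁻¹ * s) (hfr : f * r = r ^ q * f) (hq : IsCoprime (q : ℤ) ((2 * n : ℕ) : ℤ))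
    (hr2 : r ^ (2 * n) = 1) {g : G} (hg : g ∈ Subgroup.closure {s, f, r, c}) :
    ∃ j₀ j₁ j₂ j₃ : ℕ, j₀ < 2 ∧ j₁ < m ∧ j₂ < n ∧ j₃ < N ∧ g = s ^ j₀ * f ^ j₁ * r ^ j₂ * c ^ j₃ := by
  have key : ∃ (j₀ j₁ : ℕ) (z w : ℤ), g = s ^ j₀ * f ^ j₁ * r ^ z * c ^ w := by
    have hrs : ∀ z : ℤ, ∃ z' : ℤ, r ^ z * s = s * r ^ z' := by
      intro z
      have h : SemiconjBy s r r⁻¹ := hsr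
      exact ⟨-z, by rw [h.zpow_right (-z)]; simp⟩
    have hrf : ∀ z : ℤ, ∃ z' : ℤ, r ^ z * f = f * r ^ z' := by
      intro z
      obtain ⟨u, v, huv⟩ := hq
      have h : SemiconjBy f r (r ^ q) := hfr
      have h2 : r ^ ((2 * n : ℕ) : ℤ) = 1 := by rw [zpow_natCast, hr2]
      -- Moving r past f from the left needs the inverse of q modulo 2n, which is the Bézout
      -- coefficient u.
      refine ⟨u * z, ?_⟩
      rw [h.zpow_right (u * z), ← zpow_natCast, ← zpow_mul]
      congr 1
      have : z = q * (u * z) + ((2 * n : ℕ) : ℤ) * (v * z) := by linear_combination -z * huv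
      conv_lhs => rw [this, zpow_add, zpow_mul r ((2 * n : ℕ) : ℤ), h2, one_zpow, mul_one]
    have hrsf : ∀ (j₀ j₁ : ℕ) (z : ℤ), ∃ z' : ℤ,
        r ^ z * (s ^ j₀ * f ^ j₁) = s ^ j₀ * f ^ j₁ * r ^ z' := by
      intro j₀ j₁ z
      obtain ⟨z₁, h₁⟩ := SemiconjBy.exists_zpow_comm_pow (w := j₀) hrs z
      obtain ⟨z₂, h₂⟩ := SemiconjBy.exists_zpow_comm_pow (w := j₁) hrf z₁
      exact ⟨z₂, by rw [← mul_assoc, h₁, mul_assoc, h₂, mul_assoc]⟩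
    have hcsf : ∀ (w : ℤ) (j₀ j₁ : ℕ) (z : ℤ), Commute (c ^ w) (s ^ j₀ * f ^ j₁ * r ^ z) :=
      fun w j₀ j₁ z => (((hcs.pow_right _).mul_right (hcf.pow_right _)).mul_right
        (hcr.zpow_right z)).zpow_left w
    -- Arbitrary integer powers of r and c are allowed, so that their inverses are covered too; the
    -- inverses of s and f are positive powers and are treated separately.
    have step : ∀ x, (x = s ∨ x = f ∨ (∃ z : ℤ, x = r ^ z) ∨ ∃ w : ℤ, x = c ^ w) → ∀ y,
        (∃ (j₀ j₁ : ℕ) (z w : ℤ), y = s ^ j₀ * f ^ j₁ * r ^ z * c ^ w) →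
        ∃ (j₀ j₁ : ℕ) (z w : ℤ), x * y = s ^ j₀ * f ^ j₁ * r ^ z * c ^ w := by
      rintro x hx y ⟨j₀, j₁, z, w, rfl⟩
      rcases hx with rfl | rfl | ⟨z', rfl⟩ | ⟨w', rfl⟩
      · exact ⟨j₀ + 1, j₁, z, w, by simp only [pow_succ', mul_assoc]⟩
      · refine ⟨j₀, j₁ + 1, z, w, ?_⟩
        have : Commute s x := hsf
        rw [pow_succ', ← mul_assoc (s ^ j₀), (this.pow_left j₀).eq]
        simp only [mul_assoc]
      · obtain ⟨z₁, h₁⟩ := hrsf j₀ j₁ z'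
        exact ⟨j₀, j₁, z₁ + z, w, by rw [zpow_add, ← mul_assoc, ← mul_assoc, h₁, ← mul_assoc]⟩
      · refine ⟨j₀, j₁, z, w' + w, ?_⟩
        rw [zpow_add, ← mul_assoc, (hcsf w' j₀ j₁ z).eq]
        simp only [mul_assoc]
    have hsinv : s⁻¹ = s := by
      rw [inv_eq_iff_mul_eq_one, ← sq, hs]
    have stepf : ∀ (i : ℕ) y, (∃ (j₀ j₁ : ℕ) (z w : ℤ), y = s ^ j₀ * f ^ j₁ * r ^ z * c ^ w) →
        ∃ (j₀ j₁ : ℕ) (z w : ℤ), f ^ i * y = s ^ j₀ * f ^ j₁ * r ^ z * c ^ w := by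
      intro i
      induction i with
      | zero => intro y hy; simpa using hy
      | succ i ih =>
        intro y hy
        rw [pow_succ', mul_assoc]
        exact step f (Or.inr (Or.inl rfl)) _ (ih y hy)
    have hfinv : f⁻¹ = f ^ (m - 1) := by
      rw [inv_eq_iff_mul_eq_one, mul_pow_sub_one hm, hf]
    induction hg using Subgroup.closure_induction_left with
    | one => exact ⟨0, 0, 0, 0, by simp⟩
    | mul_left x hx y _ ih =>
      refine step x ?_ y ih
      rcases hx with rfl | rfl | rfl | rfl
      · exact Or.inl rfl
      · exact Or.inr (Or.inl rfl)
      · exact Or.inr (Or.inr (Or.inl ⟨1, by simp⟩))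
      · exact Or.inr (Or.inr (Or.inr ⟨1, by simp⟩))
    | inv_mul_cancel x hx y _ ih =>
      rcases hx with rfl | rfl | rfl | rfl
      · rw [hsinv]; exact step x (Or.inl rfl) y ih
      · rw [hfinv]; exact stepf _ y ih
      · exact step _ (Or.inr (Or.inr (Or.inl ⟨-1, by simp⟩))) y ih
      · exact step _ (Or.inr (Or.inr (Or.inr ⟨-1, by simp⟩))) y ih
  obtain ⟨j₀, j₁, z, w, rfl⟩ := key
  have hnI : (0 : ℤ) < n := by exact_mod_cast Nat.pos_of_ne_zero hn
  have hNI : (0 : ℤ) < N := by exact_mod_cast Nat.pos_of_ne_zero hN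
  obtain ⟨j₂, hj₂⟩ := Int.eq_ofNat_of_zero_le (Int.emod_nonneg z hnI.ne')
  -- Reducing z modulo n carries r^(n·(z/n)) = c^(p·(z/n)) into the exponent of c.
  obtain ⟨j₃, hj₃⟩ := Int.eq_ofNat_of_zero_le (Int.emod_nonneg (p * (z / n) + w) hNI.ne')
  refine ⟨j₀ % 2, j₁ % m, j₂, j₃, Nat.mod_lt _ two_pos, Nat.mod_lt _ (Nat.pos_of_ne_zero hm), ?_, ?_, ?_⟩
  · have := Int.emod_lt_of_pos z hnI; omega
  · have := Int.emod_lt_of_pos (p * (z / n) + w) hNI; omega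
  · have e1 : s ^ j₀ = s ^ (j₀ % 2) := pow_eq_pow_mod j₀ hs
    have e2 : f ^ j₁ = f ^ (j₁ % m) := pow_eq_pow_mod j₁ hf
    have e3 : r ^ z = r ^ j₂ * c ^ ((p : ℤ) * (z / n)) := by
      conv_lhs => rw [← Int.emod_add_mul_ediv z n, zpow_add, zpow_mul, zpow_natCast, hrn]
      rw [hj₂, zpow_mul]
      simp
    have e4 : c ^ ((p : ℤ) * (z / n) + w) = c ^ j₃ := by
      rw [← Int.emod_add_mul_ediv (p * (z / n) + w) N, hj₃, zpow_add, zpow_mul]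
      simp [hcN]
    rw [e1, e2, e3, ← e4, zpow_add]
    simp only [mul_assoc]

end NormalForm

/-! ### Fibres of an invariant -/

/-- On S the map w factors through p, and the equality of finite cardinals says that the factor map
is injective. It serves both for weights against orbits and for orbits of the large group against
those of the small one. -/
lemma Set.ncard_image_le_and_eq_iff {α β γ : Type*} (S : Set α) (hS : S.Finite) (p : α → β)
    (w : α → γ) (h : ∀ a ∈ S, ∀ b ∈ S, p a = p b → w a = w b) :
    (w '' S).ncard ≤ (p '' S).ncard ∧
      ((w '' S).ncard = (p '' S).ncard ↔ ∀ a ∈ S, ∀ b ∈ S, w a = w b → p a = p b) := by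
  classical
  rcases S.eq_empty_or_nonempty with rfl | ⟨a₀, ha₀⟩
  · simp
  -- The value `w a₀` is a filler outside the image of p and plays no role.
  let ψ : β → γ := fun y => if h : ∃ a ∈ S, p a = y then w h.choose else w a₀
  have hψ : ∀ a ∈ S, ψ (p a) = w a := by
    intro a ha
    have hex : ∃ b ∈ S, p b = p a := ⟨a, ha, rfl⟩
    simp only [ψ, dif_pos hex]
    exact h _ hex.choose_spec.1 _ ha hex.choose_spec.2
  have himg : w '' S = ψ '' (p '' S) := by
    rw [Set.image_image]
    exact Set.image_congr fun a ha => (hψ a ha).symm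
  rw [himg]
  refine ⟨Set.ncard_image_le (hS.image p), ?_⟩
  rw [Set.ncard_image_iff (hS.image p)]
  constructor
  · intro hinj a ha b hb hab
    exact hinj ⟨a, ha, rfl⟩ ⟨b, hb, rfl⟩ (by rw [hψ a ha, hψ b hb, hab])
  · rintro hw _ ⟨a, ha, rfl⟩ _ ⟨b, hb, rfl⟩ hab
    rw [hψ a ha, hψ b hb] at hab
    exact hw a ha b hb hab

lemma Set.ncard_image_lt_of_not_injOn {α β γ : Type*} (S : Set α) (hS : S.Finite) (p : α → β)
    (w : α → γ) (h : ∀ a ∈ S, ∀ b ∈ S, p a = p b → w a = w b)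
    {a b : α} (ha : a ∈ S) (hb : b ∈ S) (hw : w a = w b) (hp : p a ≠ p b) :
    (w '' S).ncard < (p '' S).ncard := by
  obtain ⟨h1, h2⟩ := S.ncard_image_le_and_eq_iff hS p w h
  exact lt_of_le_of_ne h1 fun he => hp (h2.mp he a ha b hb hw)

/-! ### Monomials, invariance of the weight, and relations in the group -/

namespace NegaRing

section Structure

variable (F : Type*) [Field F] (n : ℕ) [NeZero n]

lemma x_pow_two_mul : (x F n) ^ (2 * n) = 1 := by
  rw [mul_comm, pow_mul, x_pow]; simp

lemma natDegree_modulus : (X ^ n - C (-1) : F[X]).natDegree = n := natDegree_X_pow_sub_C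

/-- The basis `1, x, …, x^(n-1)`. -/
noncomputable def basis : Module.Basis (Fin n) F (NegaRing F n) :=
  (AdjoinRoot.powerBasisAux' (monic_modulus F n)).reindex (finCongr (natDegree_modulus F n))

lemma basis_repr (c : NegaRing F n) (i : Fin n) : (basis F n).repr c i = word F n c i := by
  simp only [basis, Module.Basis.repr_reindex_apply]
  rfl

lemma basis_apply (i : Fin n) : basis F n i = ((x F n) ^ (i : ℕ) : (NegaRing F n)ˣ) := by
  have h := (AdjoinRoot.powerBasis' (monic_modulus F n)).basis_eq_pow
    ((finCongr (natDegree_modulus F n)).symm i)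
  simp only [basis, Module.Basis.reindex_apply]
  exact h.trans (by simp [AdjoinRoot.powerBasis'_gen, x])

instance finite [Finite F] : Finite (NegaRing F n) :=
  have := (monic_modulus F n).finite_adjoinRoot
  Module.finite_of_finite F

/-- Since x^n = -1, reducing the exponent modulo n costs only a sign. Multipliers and the shift are
therefore monomial maps. -/
lemma exists_x_zpow_eq (l : ℤ) : ∃ (i : Fin n) (s : F), s ≠ 0 ∧
    (((x F n) ^ l : (NegaRing F n)ˣ) : NegaRing F n) = s • basis F n i := by
  have hn : (0 : ℤ) < n := by exact_mod_cast Nat.pos_of_ne_zero (NeZero.ne n)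
  obtain ⟨j, hj⟩ := Int.eq_ofNat_of_zero_le (Int.emod_nonneg l hn.ne')
  have hjn : j < n := by have := Int.emod_lt_of_pos l hn; omega
  refine ⟨⟨j, hjn⟩, (((-1 : Fˣ) ^ (l / n) : Fˣ) : F), Units.ne_zero _, ?_⟩
  rw [basis_apply]
  have e : (x F n) ^ l = (-1) ^ (l / n) * (x F n) ^ j := by
    conv_lhs => rw [← Int.emod_add_mul_ediv l n, zpow_add, zpow_mul, hj, zpow_natCast, zpow_natCast,
      x_pow, mul_comm]
  rw [e, Units.val_mul]
  rcases Int.even_or_odd (l / n) with h | h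
  · simp [h.neg_one_zpow]
  · simp [h.neg_one_zpow]

/-- A linear automorphism permuting the monomials up to scalars preserves the weight. -/
lemma weight_map_of_monomial (g : NegaRing F n ≃ₗ[F] NegaRing F n)
    (hg : ∀ i : Fin n, ∃ (j : Fin n) (s : F), s ≠ 0 ∧ g (basis F n i) = s • basis F n j)
    (c : NegaRing F n) : weight F n (g c) = weight F n c := by
  classical
  choose π s hs hgs using hg
  -- If π i = π j, suitable nonzero multiples of the i-th and j-th monomials have the same image,
  -- against the injectivity of g.
  have hinj : Function.Injective π := by
    intro i j hij
    by_contra hne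
    have h : g (s j • basis F n i) = g (s i • basis F n j) := by
      rw [map_smul, map_smul, hgs, hgs, hij, smul_comm]
    have h2 := congrArg (fun v => (basis F n).repr v i) (g.injective h)
    simp [Ne.symm hne] at h2
    exact hs j h2
  have hword : ∀ i, word F n (g c) (π i) = s i * word F n c i := by
    intro i
    rw [← basis_repr, ← basis_repr]
    conv_lhs => rw [← (basis F n).sum_repr c]
    simp only [map_sum, map_smul, hgs, Finsupp.coe_finsetSum, Finset.sum_apply, Finsupp.smul_apply,
      Module.Basis.repr_self, smul_eq_mul, Finsupp.single_apply]
    rw [Finset.sum_eq_single i]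
    · simp [mul_comm]
    · intro b _ hb
      simp [hinj.ne hb]
    · simp
  let e : Fin n ≃ Fin n := Equiv.ofBijective π (Finite.injective_iff_bijective.mp hinj)
  unfold weight hammingNorm
  symm
  refine Finset.card_equiv e fun i => ?_
  simp only [Finset.mem_filter, Finset.mem_univ, true_and]
  change _ ↔ word F n (g c) (π i) ≠ 0
  rw [hword]
  simp [hs i]

lemma shift_apply (c : NegaRing F n) : shift F n c = x F n * c := rfl

lemma scalar_apply (ξ : Fˣ) (c : NegaRing F n) : scalar F n ξ c = (ξ : F) • c := rfl

lemma multiplier_apply (a : ℤ) (ha : IsCoprime a ((2 * n : ℕ) : ℤ)) (c : NegaRing F n) :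
    multiplier F n a ha c = multiplierHom F n a ha c := rfl

lemma weight_multiplier (a : ℤ) (ha : IsCoprime a ((2 * n : ℕ) : ℤ)) (c : NegaRing F n) :
    weight F n (multiplier F n a ha c) = weight F n c := by
  refine weight_map_of_monomial F n _ (fun i => ?_) c
  rw [basis_apply, multiplier_apply, ← zpow_natCast, multiplierHom_x_zpow]
  exact exists_x_zpow_eq F n _

lemma weight_shift (c : NegaRing F n) : weight F n (shift F n c) = weight F n c := by
  refine weight_map_of_monomial F n _ (fun i => ?_) c
  rw [basis_apply, shift_apply, ← Units.val_mul, ← pow_succ', ← zpow_natCast]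
  exact exists_x_zpow_eq F n _

lemma weight_scalar (ξ : Fˣ) (c : NegaRing F n) : weight F n (scalar F n ξ c) = weight F n c :=
  weight_map_of_monomial F n _ (fun i => ⟨i, ξ, ξ.ne_zero, scalar_apply F n ξ _⟩) c

lemma linearEquiv_ext {g g' : NegaRing F n ≃ₗ[F] NegaRing F n}
    (h : ∀ l : ℕ, g ((x F n ^ l : (NegaRing F n)ˣ) : NegaRing F n) =
      g' ((x F n ^ l : (NegaRing F n)ˣ) : NegaRing F n)) : g = g' :=
  (basis F n).ext' fun i => by rw [basis_apply]; exact h i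

lemma multiplier_x_zpow (a : ℤ) (ha : IsCoprime a ((2 * n : ℕ) : ℤ)) (b : ℤ) :
    multiplier F n a ha ((x F n) ^ b : (NegaRing F n)ˣ) =
      ((x F n) ^ (a * b) : (NegaRing F n)ˣ) := multiplierHom_x_zpow F n a ha b

lemma multiplier_pow_x_zpow (a : ℤ) (ha : IsCoprime a ((2 * n : ℕ) : ℤ)) (i : ℕ) (b : ℤ) :
    (multiplier F n a ha ^ i) ((x F n) ^ b : (NegaRing F n)ˣ) =
      ((x F n) ^ (a ^ i * b) : (NegaRing F n)ˣ) := by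
  induction i generalizing b with
  | zero => simp
  | succ i ih =>
    rw [pow_succ, LinearEquiv.mul_apply, multiplier_x_zpow, ih, pow_succ, mul_assoc]

lemma multiplier_comm (a b : ℤ) (ha : IsCoprime a ((2 * n : ℕ) : ℤ))
    (hb : IsCoprime b ((2 * n : ℕ) : ℤ)) :
    multiplier F n a ha * multiplier F n b hb = multiplier F n b hb * multiplier F n a ha := by
  apply linearEquiv_ext
  intro l
  rw [← zpow_natCast, LinearEquiv.mul_apply, LinearEquiv.mul_apply, multiplier_x_zpow,
    multiplier_x_zpow, multiplier_x_zpow, multiplier_x_zpow, mul_left_comm]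

lemma multiplier_pow_eq_one (a : ℤ) (ha : IsCoprime a ((2 * n : ℕ) : ℤ)) (i : ℕ)
    (h : ((2 * n : ℕ) : ℤ) ∣ a ^ i - 1) : multiplier F n a ha ^ i = 1 := by
  apply linearEquiv_ext
  intro l
  rw [← zpow_natCast (x F n) l, multiplier_pow_x_zpow]
  obtain ⟨d, hd⟩ := h
  have : a ^ i * (l : ℤ) = ((2 * n : ℕ) : ℤ) * (d * l) + l := by linear_combination (l : ℤ) * hd
  rw [this, zpow_add, zpow_mul, zpow_natCast, x_pow_two_mul]
  simp

lemma shift_zpow_apply (z : ℤ) (c : NegaRing F n) :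
    (shift F n ^ z) c = ((x F n ^ z : (NegaRing F n)ˣ) : NegaRing F n) * c := by
  let T : (NegaRing F n)ˣ →* (NegaRing F n ≃ₗ[F] NegaRing F n) :=
    DistribMulAction.toModuleAut F (NegaRing F n)
  have : shift F n = T (x F n) := rfl
  rw [this, ← map_zpow]
  rfl

lemma scalar_pow (ξ : Fˣ) (i : ℕ) : scalar F n ξ ^ i = scalar F n (ξ ^ i) := by
  let T : Fˣ →* (NegaRing F n ≃ₗ[F] NegaRing F n) :=
    DistribMulAction.toModuleAut F (NegaRing F n)
  exact (map_pow T ξ i).symm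

lemma multiplier_shift (a : ℤ) (ha : IsCoprime a ((2 * n : ℕ) : ℤ)) :
    multiplier F n a ha * shift F n = shift F n ^ a * multiplier F n a ha := by
  refine LinearEquiv.ext fun c => ?_
  rw [LinearEquiv.mul_apply, LinearEquiv.mul_apply, shift_zpow_apply, shift_apply,
    multiplier_apply, multiplier_apply, map_mul, multiplierHom_x]

lemma scalar_commute (ξ : Fˣ) (g : NegaRing F n ≃ₗ[F] NegaRing F n) :
    Commute (scalar F n ξ) g := by
  refine LinearEquiv.ext fun c => ?_
  rw [LinearEquiv.mul_apply, LinearEquiv.mul_apply, scalar_apply, scalar_apply, map_smul]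

lemma shift_pow_card : shift F n ^ n = scalar F n (-1) := by
  refine LinearEquiv.ext fun c => ?_
  rw [← zpow_natCast, shift_zpow_apply, zpow_natCast, x_pow, scalar_apply]
  simp

lemma shift_pow_two_mul : shift F n ^ (2 * n) = 1 := by
  refine LinearEquiv.ext fun c => ?_
  rw [← zpow_natCast, shift_zpow_apply, zpow_natCast, x_pow_two_mul]
  simp

end Structure

section Group

variable (F : Type*) [Field F] [Fintype F] (n : ℕ) [NeZero n]

lemma exists_normalForm (hq : Odd (Fintype.card F)) (hn : n.Coprime (Fintype.card F))
    {ξ : Fˣ} (hξ : ∀ u : Fˣ, u ∈ Subgroup.zpowers ξ) {g : NegaRing F n ≃ₗ[F] NegaRing F n}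
    (hg : g ∈ groupNegQ F n hq hn ξ) :
    ∃ j₀ j₁ j₂ j₃ : ℕ, j₀ < 2 ∧ j₁ < orderOf ((Fintype.card F : ℕ) : ZMod (2 * n)) ∧ j₂ < n ∧
      j₃ < Fintype.card F - 1 ∧
      g = muNegOne F n ^ j₀ * muQ F n hq hn ^ j₁ * shift F n ^ j₂ * scalar F n ξ ^ j₃ := by
  have hq1 : 1 < Fintype.card F := Fintype.one_lt_card
  have hunit : IsUnit ((Fintype.card F : ℕ) : ZMod (2 * n)) :=
    (ZMod.isUnit_iff_coprime _ _).mpr (Nat.isCoprime_iff_coprime.mp (isCoprime_card F n hq hn))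
  -- The n-th power of the shift is the scalar -1, so p is the exponent in the relation r^n = c^p.
  obtain ⟨p, hp⟩ : ∃ p : ℕ, ξ ^ p = -1 := by
    obtain ⟨p, hp⟩ := (mem_powers_iff_mem_zpowers (x := ξ)).mpr (hξ (-1))
    exact ⟨p, hp⟩
  have hm0 : orderOf ((Fintype.card F : ℕ) : ZMod (2 * n)) ≠ 0 := by
    obtain ⟨u, hu⟩ := hunit
    rw [← hu, orderOf_units]
    exact (orderOf_pos u).ne'
  refine exists_normalForm_of_mem_closure (q := Fintype.card F) (p := p) (NeZero.ne n) hm0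
    (by omega) ?_ ?_ ?_ (scalar_commute F n ξ _) (scalar_commute F n ξ _) (scalar_commute F n ξ _)
    ?_ ?_ ?_ ?_ (isCoprime_card F n hq hn) (shift_pow_two_mul F n) hg
  · exact multiplier_pow_eq_one F n _ _ _ (by simp)
  · refine multiplier_pow_eq_one F n _ _ _ ?_
    rw [← ZMod.intCast_zmod_eq_zero_iff_dvd]
    push_cast
    rw [pow_orderOf_eq_one, sub_self]
  · exact multiplier_comm F n _ _ _ _
  · rw [shift_pow_card, scalar_pow, hp]
  · classical
    rw [scalar_pow, ← Fintype.card_units, pow_card_eq_one]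
    exact LinearEquiv.ext fun c => by rw [scalar_apply]; simp
  · rw [muNegOne, multiplier_shift, zpow_neg_one]
  · rw [muQ, multiplier_shift, zpow_natCast]

lemma weight_map_groupNegQ (hq : Odd (Fintype.card F)) (hn : n.Coprime (Fintype.card F))
    {ξ : Fˣ} {g : NegaRing F n ≃ₗ[F] NegaRing F n}
    (hg : g ∈ groupNegQ F n hq hn ξ) (c : NegaRing F n) : weight F n (g c) = weight F n c := by
  induction hg using Subgroup.closure_induction generalizing c with
  | mem g hg =>
    rcases hg with rfl | rfl | rfl | rfl
    · exact weight_multiplier F n _ _ c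
    · exact weight_multiplier F n _ _ c
    · exact weight_shift F n c
    · exact weight_scalar F n ξ c
  | one => rfl
  | mul g g' _ _ h h' => rw [LinearEquiv.mul_apply, h, h']
  | inv g _ h => rw [← h (g⁻¹ c), ← LinearEquiv.mul_apply, mul_inv_cancel]; rfl

end Group

end NegaRing

/-! ### Evaluation at the roots of x^n + 1 -/

namespace NegaRing

section Eval

variable {F : Type*} [Field F] {K : Type*} [Field K] [Algebra F K] {n : ℕ}

/-- Evaluation at a root `y` of `X ^ n + 1`. -/
noncomputable def evalAt (F : Type*) [Field F] {K : Type*} [Field K] [Algebra F K] {n : ℕ}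
    {y : K} (hy : y ^ n = -1) : NegaRing F n →ₐ[F] K :=
  AdjoinRoot.liftAlgHom _ (Algebra.ofId F K) y (by simp [hy])

lemma evalAt_mk {y : K} (hy : y ^ n = -1) (p : F[X]) :
    evalAt F hy (AdjoinRoot.mk _ p) = aeval y p := by
  rw [evalAt, AdjoinRoot.liftAlgHom_mk, aeval_def]; rfl

lemma evalAt_root {y : K} (hy : y ^ n = -1) :
    evalAt F hy (AdjoinRoot.root (X ^ n - C (-1) : F[X])) = y :=
  AdjoinRoot.liftAlgHom_root _ _ _ _

lemma evalAt_congr {y y' : K} (h : y = y') (hy : y ^ n = -1) (hy' : y' ^ n = -1)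
    (c : NegaRing F n) : evalAt F hy c = evalAt F hy' c := by
  subst h; rfl

lemma ne_zero_of_pow_eq_neg_one [NeZero n] {y : K} (hy : y ^ n = -1) : y ≠ 0 := by
  rintro rfl
  rw [zero_pow (NeZero.ne n)] at hy
  exact one_ne_zero (neg_eq_zero.mp hy.symm)

lemma inv_pow_eq_neg_one {y : K} (hy : y ^ n = -1) : y⁻¹ ^ n = -1 := by
  rw [inv_pow, hy, inv_neg, inv_one]

lemma pow_pow_eq_neg_one {y : K} (hy : y ^ n = -1) {i : ℕ} (hi : Odd i) : (y ^ i) ^ n = -1 := by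
  rw [← pow_mul, mul_comm, pow_mul, hy, hi.neg_one_pow]

variable [NeZero n]

lemma evalAt_x {y : K} (hy : y ^ n = -1) : evalAt F hy (x F n) = y := evalAt_root hy

lemma evalAt_x_zpow {y : K} (hy : y ^ n = -1) (l : ℤ) :
    evalAt F hy ((x F n ^ l : (NegaRing F n)ˣ) : NegaRing F n) = y ^ l := by
  have h : Units.map (evalAt F hy : NegaRing F n →* K) (x F n) =
      Units.mk0 y (ne_zero_of_pow_eq_neg_one hy) := Units.ext (evalAt_x hy)
  have h2 := congrArg (fun u : Kˣ => ((u ^ l : Kˣ) : K)) h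
  simp only [← map_zpow] at h2
  rw [Units.val_zpow_eq_zpow_val] at h2
  exact h2

lemma evalAt_multiplier {a : ℤ} (ha : IsCoprime a ((2 * n : ℕ) : ℤ)) {y : K} (hy : y ^ n = -1)
    (hya : (y ^ a) ^ n = -1) (c : NegaRing F n) :
    evalAt F hy (multiplier F n a ha c) = evalAt F hya c := by
  have : (evalAt F hy).comp (multiplierHom F n a ha) = evalAt F hya := by
    apply AdjoinRoot.algHom_ext
    rw [AlgHom.comp_apply, evalAt_root]
    exact (congrArg _ (multiplierHom_x F n a ha)).trans (evalAt_x_zpow hy a)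
  exact DFunLike.congr_fun this c

lemma evalAt_muNegOne {y : K} (hy : y ^ n = -1) (c : NegaRing F n) :
    evalAt F hy (muNegOne F n c) = evalAt F (inv_pow_eq_neg_one hy) c := by
  rw [muNegOne, evalAt_multiplier _ hy (by rw [zpow_neg_one]; exact inv_pow_eq_neg_one hy)]
  exact evalAt_congr (zpow_neg_one y) _ _ c

lemma evalAt_shift {y : K} (hy : y ^ n = -1) (c : NegaRing F n) :
    evalAt F hy (shift F n c) = y * evalAt F hy c := by
  rw [shift_apply, map_mul, evalAt_x]

lemma evalAt_scalar (ξ : Fˣ) {y : K} (hy : y ^ n = -1) (c : NegaRing F n) :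
    evalAt F hy (scalar F n ξ c) = algebraMap F K ξ * evalAt F hy c := by
  rw [scalar_apply, map_smul, Algebra.smul_def]

lemma evalAt_baseChange {y : K} (hy : y ^ n = -1) (c : NegaRing F n) :
    evalAt K hy (baseChange F n K c) = evalAt F hy c := by
  induction c using AdjoinRoot.induction_on with
  | ih p =>
    have h : baseChange F n K (AdjoinRoot.mk _ p) = AdjoinRoot.mk _ (p.map (algebraMap F K)) := by
      simp [baseChange, AdjoinRoot.map]
      rw [← Polynomial.eval₂_map]
      exact AdjoinRoot.aeval_eq _
    rw [h, evalAt_mk, evalAt_mk, aeval_map_algebraMap]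

lemma pow_eq_neg_one_of_isPrimitiveRoot {ζ : K} (hζ : IsPrimitiveRoot ζ (2 * n)) : ζ ^ n = -1 := by
  have h1 : (ζ ^ n) ^ 2 = 1 := by rw [← pow_mul, mul_comm, hζ.pow_eq_one]
  rcases eq_or_eq_neg_of_sq_eq_sq (ζ ^ n) 1 (by rw [h1, one_pow]) with h2 | h2
  · have := Nat.le_of_dvd (Nat.pos_of_ne_zero (NeZero.ne n)) ((hζ.pow_eq_one_iff_dvd n).mp h2)
    have := NeZero.pos n
    omega
  · exact h2

/-- An element vanishing at all the roots of `X ^ n + 1` is zero. -/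
lemma eq_zero_of_evalAt_eq_zero {ζ : K} (hζ : IsPrimitiveRoot ζ (2 * n)) {c : NegaRing F n}
    (h : ∀ (y : K) (hy : y ^ n = -1), evalAt F hy c = 0) : c = 0 := by
  have hζn := pow_eq_neg_one_of_isPrimitiveRoot hζ
  set p := AdjoinRoot.modByMonicHom (monic_modulus F n) c with hp
  have hc : AdjoinRoot.mk _ p = c := AdjoinRoot.mk_leftInverse (monic_modulus F n) c
  have hdeg : p.natDegree < n := by
    obtain ⟨f, rfl⟩ := AdjoinRoot.mk_surjective c
    rw [hp, AdjoinRoot.modByMonicHom_mk]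
    have := natDegree_modByMonic_lt f (monic_modulus F n) (by
      intro h1
      have := congrArg natDegree h1
      rw [natDegree_modulus, natDegree_one] at this
      exact NeZero.ne n this)
    rwa [natDegree_modulus] at this
  have h0 : p.map (algebraMap F K) = 0 := by
    -- The odd powers of ζ give n distinct roots, too many for a nonzero representative of degree
    -- below n.
    refine eq_zero_of_natDegree_lt_card_of_eval_eq_zero _
      (f := fun i : Fin n => ζ ^ (2 * (i : ℕ) + 1)) ?_ ?_ ?_
    · intro i j hij
      have := hζ.pow_inj (by omega) (by omega) hij
      exact Fin.ext (by omega)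
    · intro i
      have := h (ζ ^ (2 * (i : ℕ) + 1)) (pow_pow_eq_neg_one hζn ⟨i, rfl⟩)
      rw [← hc, evalAt_mk, ← aeval_map_algebraMap K, coe_aeval_eq_eval] at this
      exact this
    · rw [natDegree_map, Fintype.card_fin]; exact hdeg
  rw [← hc, (Polynomial.map_eq_zero _).mp h0, map_zero]

/-- Orthogonality of characters: the value is 1/n times the geometric sum of ζ^(-j)·y, which is an
n-th root of unity because ζ^j and y both have n-th power -1. -/
lemma evalAt_splitIdempotent {ζ : K} (hn0 : (n : K) ≠ 0) {j : ZMod (2 * n)}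
    (hj : (ζ ^ j.val) ^ n = -1) {y : K} (hy : y ^ n = -1) [Decidable (y = ζ ^ j.val)] :
    evalAt K hy (splitIdempotent n ζ j) = if y = ζ ^ j.val then 1 else 0 := by
  have hz := ne_zero_of_pow_eq_neg_one hj
  have h1 : evalAt K hy (splitIdempotent n ζ j) =
      (n : K)⁻¹ * ∑ l ∈ Finset.range n, ((ζ ^ j.val)⁻¹ * y) ^ l := by
    rw [splitIdempotent, map_sum, Finset.mul_sum]
    refine Finset.sum_congr rfl fun l _ => ?_
    rw [map_smul, ← zpow_natCast (x K n) l, evalAt_x_zpow, zpow_natCast, smul_eq_mul, mul_assoc, mul_pow,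
      pow_mul, inv_pow ζ]
  rw [h1]
  split_ifs with h
  · rw [h, inv_mul_cancel₀ hz]
    simp [hn0]
  · have hw : ((ζ ^ j.val)⁻¹ * y) ^ n = 1 := by
      rw [mul_pow, inv_pow, hj, hy]; simp
    have h2 := mul_geom_sum ((ζ ^ j.val)⁻¹ * y) n
    rw [hw, sub_self] at h2
    rcases mul_eq_zero.mp h2 with h3 | h3
    · refine absurd ?_ h
      rw [sub_eq_zero, inv_mul_eq_one₀ hz] at h3
      exact h3.symm
    · rw [h3, mul_zero]

end Eval

lemma mem_cyclotomicCoset {N q : ℕ} [NeZero N] {b j : ZMod N} :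
    j ∈ cyclotomicCoset N q b ↔ ∃ i : ℕ, j = b * (q : ZMod N) ^ i := by
  classical
  simp [cyclotomicCoset]

/-- The coset is the orbit of b under z ↦ zq, so its size is the minimal period of b. -/
lemma card_cyclotomicCoset_dvd_iff {N q : ℕ} [NeZero N] (hq : IsUnit (q : ZMod N)) (b : ZMod N) :
    (cyclotomicCoset N q b).card ≠ 0 ∧
      ∀ i : ℕ, b * (q : ZMod N) ^ i = b ↔ (cyclotomicCoset N q b).card ∣ i := by
  classical
  let f : ZMod N → ZMod N := fun z => z * q
  have hit : ∀ i z, f^[i] z = z * (q : ZMod N) ^ i := by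
    intro i z
    exact congrFun (mul_right_iterate (q : ZMod N) i) z
  have hcard : (cyclotomicCoset N q b).card = Function.minimalPeriod f b := by
    have hper : b ∈ Function.periodicPts f := by
      obtain ⟨u, hu⟩ := hq
      refine ⟨orderOf u, orderOf_pos u, ?_⟩
      rw [Function.IsPeriodicPt, Function.IsFixedPt, hit, ← hu, ← Units.val_pow_eq_pow_val,
        pow_orderOf_eq_one, Units.val_one, mul_one]
    have himg : cyclotomicCoset N q b =
        (Finset.range (Function.minimalPeriod f b)).image (fun i => f^[i] b) := by
      ext j
      rw [mem_cyclotomicCoset, Finset.mem_image]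
      constructor
      · rintro ⟨i, rfl⟩
        refine ⟨i % Function.minimalPeriod f b, Finset.mem_range.mpr (Nat.mod_lt _
          (Function.minimalPeriod_pos_of_mem_periodicPts hper)), ?_⟩
        rw [Function.iterate_mod_minimalPeriod_eq, hit]
      · rintro ⟨i, _, rfl⟩
        exact ⟨i, hit i b⟩
    rw [himg, Finset.card_image_of_injOn, Finset.card_range]
    intro i hi j hj hij
    rw [Finset.coe_range] at hi hj
    exact Function.iterate_injOn_Iio_minimalPeriod hi hj hij
  refine ⟨?_, fun i => ?_⟩
  · exact Finset.card_ne_zero_of_mem (mem_cyclotomicCoset.mpr ⟨0, by rw [pow_zero, mul_one]⟩)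
  · rw [hcard, ← Function.isPeriodicPt_iff_minimalPeriod_dvd, ← hit]
    rfl

end NegaRing

/-! ### The irreducible code and the field of its values -/

namespace NegaRing

section Code

variable {F : Type*} [Field F] [Fintype F] {K : Type*} [Field K] [Algebra F K] {n : ℕ} [NeZero n]
  (hq : Odd (Fintype.card F)) (hn : n.Coprime (Fintype.card F)) {ζ : K}
  (hζ : IsPrimitiveRoot ζ (2 * n)) (a : ℕ)

include hζ in
lemma root_pow_eq_neg_one : (ζ ^ (1 + 2 * a)) ^ n = -1 :=
  pow_pow_eq_neg_one (pow_eq_neg_one_of_isPrimitiveRoot hζ) ⟨a, by ring⟩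

include hζ in
lemma pow_val_natCast (i : ℕ) : ζ ^ (i : ZMod (2 * n)).val = ζ ^ i := by
  rw [ZMod.val_natCast]
  exact (pow_eq_pow_mod i hζ.pow_eq_one).symm

include hζ in
lemma pow_val_injective {i j : ZMod (2 * n)} (h : ζ ^ i.val = ζ ^ j.val) : i = j :=
  ZMod.val_injective _ (hζ.pow_inj (ZMod.val_lt i) (ZMod.val_lt j) h)

include hζ in
lemma pow_val_eq (i : ℕ) :
    ζ ^ ((1 + 2 * a : ZMod (2 * n)) * ((Fintype.card F : ℕ) : ZMod (2 * n)) ^ i).val =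
      (ζ ^ (1 + 2 * a)) ^ (Fintype.card F ^ i) := by
  have := pow_val_natCast hζ ((1 + 2 * a) * Fintype.card F ^ i)
  push_cast at this
  rw [this, pow_mul]

include hζ in
lemma natCast_ne_zero_of_isPrimitiveRoot : (n : K) ≠ 0 := by
  have : NeZero (2 * n) := ⟨mul_ne_zero two_ne_zero (NeZero.ne n)⟩
  have h := hζ.neZero'.out
  intro h0
  apply h
  push_cast
  rw [h0, mul_zero]

open Classical in
lemma evalAt_primitiveIdempotent {y : K} (hy : y ^ n = -1) :
    evalAt F hy (primitiveIdempotent F n hq hn hζ (1 + 2 * a)) =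
      if ∃ i : ℕ, y = (ζ ^ (1 + 2 * a)) ^ (Fintype.card F ^ i) then 1 else 0 := by
  have hβ := root_pow_eq_neg_one hζ a
  have hterm : ∀ j ∈ cyclotomicCoset (2 * n) (Fintype.card F) (1 + 2 * a : ZMod (2 * n)),
      evalAt K hy (splitIdempotent n ζ j) = if y = ζ ^ j.val then 1 else 0 := by
    intro j hj
    obtain ⟨i, rfl⟩ := mem_cyclotomicCoset.mp hj
    refine evalAt_splitIdempotent (natCast_ne_zero_of_isPrimitiveRoot hζ) ?_ hy
    rw [pow_val_eq hζ]
    exact pow_pow_eq_neg_one hβ hq.pow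
  rw [← evalAt_baseChange (K := K), baseChange_primitiveIdempotent, map_sum,
    Finset.sum_congr rfl hterm]
  split_ifs with h
  · obtain ⟨i, rfl⟩ := h
    rw [Finset.sum_eq_single ((1 + 2 * a : ZMod (2 * n)) * ((Fintype.card F : ℕ) : ZMod (2 * n)) ^ i)]
    · rw [if_pos (pow_val_eq hζ a i).symm]
    · intro j _ hj
      rw [if_neg]
      rw [← pow_val_eq hζ]
      exact fun h => hj (pow_val_injective hζ h).symm
    · exact fun h => absurd (mem_cyclotomicCoset.mpr ⟨i, rfl⟩) h
  · refine Finset.sum_eq_zero fun j hj => if_neg fun hyj => h ?_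
    obtain ⟨i, rfl⟩ := mem_cyclotomicCoset.mp hj
    exact ⟨i, by rw [hyj, pow_val_eq hζ]⟩

lemma mul_primitiveIdempotent_mem (c : NegaRing F n) (b : ZMod (2 * n)) :
    c * primitiveIdempotent F n hq hn hζ b ∈ irreducibleCode F n hq hn hζ b :=
  Ideal.mem_span_singleton'.mpr ⟨c, rfl⟩

/-- The idempotent takes the value 1 at the conjugates of β = ζ^(1+2a) and 0 at the other roots.
Hence an element vanishing at the other roots is unchanged when multiplied by it. -/
lemma mem_irreducibleCode_iff (c : NegaRing F n) :
    c ∈ irreducibleCode F n hq hn hζ (1 + 2 * a) ↔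
      ∀ (y : K) (hy : y ^ n = -1), (∀ i : ℕ, y ≠ (ζ ^ (1 + 2 * a)) ^ (Fintype.card F ^ i)) →
        evalAt F hy c = 0 := by
  classical
  constructor
  · intro hc y hy h
    obtain ⟨r, rfl⟩ := Ideal.mem_span_singleton'.mp hc
    rw [map_mul, evalAt_primitiveIdempotent, if_neg (by push Not; exact h), mul_zero]
  · intro h
    have : c = c * primitiveIdempotent F n hq hn hζ (1 + 2 * a) := by
      rw [← sub_eq_zero]
      refine eq_zero_of_evalAt_eq_zero hζ fun y hy => ?_
      rw [map_sub, map_mul, evalAt_primitiveIdempotent]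
      split_ifs with hi
      · rw [mul_one, sub_self]
      · rw [h y hy (by push Not at hi; exact hi), zero_mul, sub_zero]
    rw [this]
    exact mul_primitiveIdempotent_mem hq hn hζ c _

lemma frobeniusAlgHom_pow_apply (i : ℕ) (z : K) :
    (FiniteField.frobeniusAlgHom F K ^ i) z = z ^ (Fintype.card F ^ i) := by
  induction i with
  | zero => simp
  | succ i ih =>
    rw [pow_succ', AlgHom.mul_apply, ih, pow_succ, pow_mul]
    rfl

/-- The coefficients lie in F and are fixed by the q-Frobenius, so c(y^(q^i)) = c(y)^(q^i). -/
lemma evalAt_pow_card {y : K} (hy : y ^ n = -1) (i : ℕ)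
    (hyi : (y ^ (Fintype.card F ^ i)) ^ n = -1) (c : NegaRing F n) :
    evalAt F hyi c = (evalAt F hy c) ^ (Fintype.card F ^ i) := by
  have : evalAt F hyi = (FiniteField.frobeniusAlgHom F K ^ i).comp (evalAt F hy) := by
    apply AdjoinRoot.algHom_ext
    rw [AlgHom.comp_apply, evalAt_root, evalAt_root, frobeniusAlgHom_pow_apply]
  rw [this, AlgHom.comp_apply, frobeniusAlgHom_pow_apply]

lemma eq_zero_of_mem_irreducibleCode {c : NegaRing F n}
    (hc : c ∈ irreducibleCode F n hq hn hζ (1 + 2 * a))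
    (h : evalAt F (root_pow_eq_neg_one hζ a) c = 0) : c = 0 := by
  refine eq_zero_of_evalAt_eq_zero hζ fun y hy => ?_
  by_cases hi : ∃ i : ℕ, y = (ζ ^ (1 + 2 * a)) ^ (Fintype.card F ^ i)
  · obtain ⟨i, rfl⟩ := hi
    rw [evalAt_pow_card (root_pow_eq_neg_one hζ a), h, zero_pow (pow_ne_zero _ Fintype.card_ne_zero)]
  · exact (mem_irreducibleCode_iff hq hn hζ a c).mp hc y hy (by push Not at hi; exact hi)

lemma exists_mem_irreducibleCode_evalAt_eq (r : NegaRing F n) :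
    ∃ c ∈ irreducibleCode F n hq hn hζ (1 + 2 * a),
      evalAt F (root_pow_eq_neg_one hζ a) c = evalAt F (root_pow_eq_neg_one hζ a) r := by
  classical
  refine ⟨_, mul_primitiveIdempotent_mem hq hn hζ r _, ?_⟩
  rw [map_mul, evalAt_primitiveIdempotent, if_pos ⟨0, by simp⟩, mul_one]

include hζ in
lemma root_pow_pow_eq_self_iff (i : ℕ) :
    (ζ ^ (1 + 2 * a)) ^ (Fintype.card F ^ i) = ζ ^ (1 + 2 * a) ↔
      (1 + 2 * a : ZMod (2 * n)) * ((Fintype.card F : ℕ) : ZMod (2 * n)) ^ i = 1 + 2 * a := by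
  have h0 := pow_val_eq (F := F) hζ a 0
  rw [pow_zero, pow_zero, mul_one, pow_one] at h0
  rw [← pow_val_eq hζ, ← h0]
  exact ⟨fun h => pow_val_injective hζ h, fun h => by rw [h]⟩

include hζ in
-- This is how the hypothesis on Γ is used: β⁻¹ is not a conjugate of β, so words of the irreducible
-- code vanish there.
lemma inv_root_ne_of_neg_notMem
    (hneg : -(1 + 2 * a : ZMod (2 * n)) ∉ cyclotomicCoset (2 * n) (Fintype.card F) (1 + 2 * a))
    (i : ℕ) : (ζ ^ (1 + 2 * a))⁻¹ ≠ (ζ ^ (1 + 2 * a)) ^ (Fintype.card F ^ i) := by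
  intro h
  apply hneg
  rw [mem_cyclotomicCoset]
  refine ⟨i, ?_⟩
  have h1 : ζ ^ ((1 + 2 * a) * (1 + Fintype.card F ^ i)) = 1 := by
    rw [pow_mul, pow_add, pow_one, ← h, mul_inv_cancel₀]
    exact ne_zero_of_pow_eq_neg_one (root_pow_eq_neg_one hζ a)
  have h2 := (ZMod.natCast_eq_zero_iff _ _).mpr (hζ.dvd_of_pow_eq_one _ h1)
  push_cast at h2
  linear_combination -h2

/-- The values at a root of `X ^ n + 1` form a finite field, whose nonzero elements are the powers
of a primitive element. -/
lemma exists_generator_range_evalAt {β : K} (hβ : β ^ n = -1) {k : ℕ} (hk0 : k ≠ 0)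
    (hk : ∀ i : ℕ, β ^ (Fintype.card F ^ i) = β ↔ k ∣ i) :
    ∃ θ : Kˣ, orderOf θ = Fintype.card F ^ k - 1 ∧
      ∀ y : K, (∃ c, evalAt F hβ c = y) ↔ y = 0 ∨ ∃ i : ℤ, y = (θ ^ i : Kˣ) := by
  classical
  have hint : IsIntegral F β := by
    refine ⟨X ^ n - C (-1), monic_modulus F n, ?_⟩
    simp [hβ]
  let L := IntermediateField.adjoin F {β}
  have hL : ∀ y : K, y ∈ L ↔ ∃ c, evalAt F hβ c = y := by
    intro y
    have h1 : L.toSubalgebra = (evalAt F hβ).range := by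
      rw [IntermediateField.adjoin_simple_toSubalgebra_of_isAlgebraic hint.isAlgebraic,
        ← Algebra.map_top, ← AdjoinRoot.adjoinRoot_eq_top, AlgHom.map_adjoin, Set.image_singleton,
        evalAt_root]
    rw [← IntermediateField.mem_toSubalgebra, h1]
    rfl
  have hLfin : Finite L := by
    have : Function.Surjective (fun c : NegaRing F n => (⟨evalAt F hβ c, (hL _).mpr ⟨c, rfl⟩⟩ : L)) := by
      rintro ⟨y, hy⟩
      obtain ⟨c, rfl⟩ := (hL y).mp hy
      exact ⟨c, rfl⟩
    exact Finite.of_surjective _ this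
  have := Fintype.ofFinite L
  have hq1 : 1 < Fintype.card F := Fintype.one_lt_card
  have hpow : ∀ y ∈ L, y ^ (Fintype.card F ^ k) = y := by
    intro y hy
    obtain ⟨c, rfl⟩ := (hL y).mp hy
    have h := (hk k).mpr dvd_rfl
    rw [← evalAt_pow_card hβ k (by rw [h]; exact hβ)]
    exact evalAt_congr h _ _ c
  -- The degree d of L = F(β) equals k by two bounds: β ∈ L is fixed by y ↦ y^(q^d), so k ∣ d; and
  -- all elements of L are roots of X^(q^k) - X, so q^d ≤ q^k.
  have hcard : Nat.card L = Fintype.card F ^ k := by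
    have h1 := Module.natCard_eq_pow_finrank (K := F) (V := L)
    rw [Nat.card_eq_fintype_card (α := F)] at h1
    have h2 : k ∣ Module.finrank F L := by
      rw [← hk, ← h1]
      have := FiniteField.pow_card (⟨β, IntermediateField.mem_adjoin_simple_self F β⟩ : L)
      rw [← Nat.card_eq_fintype_card] at this
      exact congrArg Subtype.val this
    have h3 : Nat.card L ≤ Fintype.card F ^ k := by
      have hne := FiniteField.X_pow_card_pow_sub_X_ne_zero K hk0 hq1
      have hle := card_roots' (X ^ (Fintype.card F ^ k) - X : K[X])
      rw [FiniteField.X_pow_card_pow_sub_X_natDegree_eq K hk0 hq1] at hle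
      refine le_trans ?_ ((Multiset.toFinset_card_le _).trans hle)
      rw [Nat.card_eq_fintype_card, ← Finset.card_univ]
      refine Finset.card_le_card_of_injOn (fun y : L => (y : K)) ?_ (fun _ _ _ _ h => Subtype.ext h)
      intro y _
      simp only [Finset.mem_coe, Multiset.mem_toFinset]
      rw [mem_roots hne]
      simp [IsRoot, hpow y y.2]
    rw [h1] at h3 ⊢
    have h4 := (Nat.pow_le_pow_iff_right hq1).mp h3
    have h5 := Nat.le_of_dvd Module.finrank_pos h2
    rw [le_antisymm h4 h5]
  obtain ⟨g, hg⟩ := IsCyclic.exists_generator (α := Lˣ)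
  refine ⟨Units.map (L.val : L →* K) g, ?_, ?_⟩
  · rw [orderOf_injective _ (Units.map_injective Subtype.val_injective),
      orderOf_eq_card_of_forall_mem_zpowers hg, Nat.card_eq_fintype_card, Fintype.card_units,
      ← Nat.card_eq_fintype_card, hcard]
  · intro y
    rw [← hL]
    constructor
    · intro hy
      by_cases hy0 : y = 0
      · exact Or.inl hy0
      · right
        obtain ⟨i, hi⟩ := hg (Units.mk0 ⟨y, hy⟩ (fun h => hy0 (congrArg Subtype.val h)))
        refine ⟨i, ?_⟩
        rw [← map_zpow]
        have := congrArg (fun u : Lˣ => ((u : L) : K)) hi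
        exact this.symm
    · rintro (rfl | ⟨i, rfl⟩)
      · exact L.zero_mem
      · rw [← map_zpow]
        exact ((g ^ i : Lˣ) : L).2

end Code
end NegaRing

/-! ### Counting orbits through a parametrization by a lattice quotient -/

namespace NegaRing

section Parametrization

/-- If the orbits of a finite group on the image of `pt : Z → α` are described by translations
by `Λ` and the endomorphisms `f` and `s`, then they are counted by Burnside's lemma. -/
theorem two_mul_card_orbits {Gr α Z : Type*} [Group Gr] [Finite Gr] [MulAction Gr α]
    [AddCommGroup Z] (T : Set Gr) (pt : Z → α) (Λ : AddSubgroup Z)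
    (hΛ : Λ.index ≠ 0) (f s : AddMonoid.End Z) {m : ℕ} (hm : m ≠ 0)
    (hfΛ : ∀ z ∈ Λ, f z ∈ Λ) (hsΛ : ∀ z ∈ Λ, s z ∈ Λ) (hfm : ∀ z, (f ^ m) z - z ∈ Λ)
    (hs2 : s ^ 2 = 1) (hc : Commute s f)
    (hgen : ∀ g ∈ T, ∀ z, ∃ e h : ℕ, ∃ l ∈ Λ, g • pt z = pt ((s ^ e * f ^ h) z + l))
    (htrans : ∀ l ∈ Λ, ∀ z, pt (z + l) ∈ MulAction.orbit (Subgroup.closure T) (pt z))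
    (hforb : ∀ z, pt (f z) ∈ MulAction.orbit (Subgroup.closure T) (pt z))
    (hsorb : ∀ z, pt (s z) ∈ MulAction.orbit (Subgroup.closure T) (pt z))
    (hinj : ∀ z z', pt z = pt z' → z - z' ∈ Λ) :
    2 * m * (Set.range fun z => MulAction.orbit (Subgroup.closure T) (pt z)).ncard =
      ∑ h ∈ Finset.range m,
        ((Λ ⊔ AddMonoidHom.range (f ^ h - 1 : AddMonoid.End Z)).index +
          (Λ ⊔ AddMonoidHom.range (s * f ^ h - 1 : AddMonoid.End Z)).index) := by
  refine two_mul_card_classes Λ hΛ f s hm hfΛ hsΛ hfm hs2 hc _ fun z z' => ?_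
  have hsfΛ : ∀ (e h : ℕ), ∀ z ∈ Λ, (s ^ e * f ^ h) z ∈ Λ := by
    intro e h
    have h1 : ∀ z ∈ Λ, (f ^ h) z ∈ Λ := by
      induction h with
      | zero => intro z hz; exact hz
      | succ h ih => intro z hz; rw [pow_succ]; exact ih _ (hfΛ z hz)
    have h2 : ∀ z ∈ Λ, (s ^ e) z ∈ Λ := by
      induction e with
      | zero => intro z hz; exact hz
      | succ h ih => intro z hz; rw [pow_succ]; exact ih _ (hsΛ z hz)
    exact fun z hz => h2 _ (h1 z hz)
  rw [MulAction.orbit_eq_iff]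
  constructor
  · intro hzz'
    obtain ⟨⟨g, hg⟩, hgz⟩ := MulAction.mem_orbit_symm.mp hzz'
    change g • pt z = pt z' at hgz
    have hstep : ∀ z, ∃ e h : ℕ, ∃ l ∈ Λ, g • pt z = pt ((s ^ e * f ^ h) z + l) := by
      -- The group is finite, so its elements are products of generators without inverses, and the
      -- hypothesis on generators suffices.
      rw [← Subgroup.mem_toSubmonoid, Subgroup.closure_toSubmonoid_of_finite] at hg
      clear hgz
      induction hg using Submonoid.closure_induction with
      | mem g hg => exact hgen g hg
      | one => exact fun z => ⟨0, 0, 0, Λ.zero_mem, by simp⟩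
      | mul g g' _ _ ih ih' =>
        intro z
        obtain ⟨e', h', l', hl', h1⟩ := ih' z
        obtain ⟨e, h, l, hl, h2⟩ := ih ((s ^ e' * f ^ h') z + l')
        refine ⟨e + e', h + h', (s ^ e * f ^ h) l' + l, Λ.add_mem (hsfΛ e h l' hl') hl, ?_⟩
        rw [mul_smul, h1, h2, map_add, add_assoc]
        congr 2
        have : s ^ (e + e') * f ^ (h + h') = s ^ e * f ^ h * (s ^ e' * f ^ h') := by
          rw [pow_add, pow_add, mul_assoc, mul_assoc, ← mul_assoc (f ^ h),
            ((hc.symm.pow_left h).pow_right e').eq, mul_assoc]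
        rw [this]
        rfl
    obtain ⟨e, h, l, hl, h1⟩ := hstep z
    refine ⟨e, h, ?_⟩
    have h2 := hinj _ _ (h1.symm.trans hgz)
    have : (s ^ e * f ^ h) z - z' = (s ^ e * f ^ h) z + l - z' - l := by abel
    rw [this]
    exact Λ.sub_mem h2 hl
  · rintro ⟨e, h, hl⟩
    have hf' : ∀ (h : ℕ) z, pt ((f ^ h) z) ∈ MulAction.orbit (Subgroup.closure T) (pt z) := by
      intro h
      induction h with
      | zero => exact fun z => MulAction.mem_orbit_self _
      | succ h ih =>
        intro z
        rw [pow_succ]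
        have := MulAction.orbit_eq_iff.mpr (hforb z)
        rw [← this]
        exact ih (f z)
    have hs' : ∀ (h : ℕ) z, pt ((s ^ h) z) ∈ MulAction.orbit (Subgroup.closure T) (pt z) := by
      intro h
      induction h with
      | zero => exact fun z => MulAction.mem_orbit_self _
      | succ h ih =>
        intro z
        rw [pow_succ]
        have := MulAction.orbit_eq_iff.mpr (hsorb z)
        rw [← this]
        exact ih (s z)
    have h1 := htrans _ (Λ.neg_mem hl) ((s ^ e * f ^ h) z)
    rw [neg_sub, add_sub_cancel] at h1
    rw [← MulAction.orbit_eq_iff] at h1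
    rw [MulAction.mem_orbit_symm, ← MulAction.orbit_eq_iff, h1, MulAction.orbit_eq_iff]
    have h2 := MulAction.orbit_eq_iff.mpr (hf' h z)
    rw [← h2]
    exact hs' e _

end Parametrization

/-! ### Orbit counts on the axes and on the torus of a pair code -/

lemma orbitCount_range {F : Type*} [Field F] {n : ℕ} {Z : Type*}
    (G : Subgroup (NegaRing F n ≃ₗ[F] NegaRing F n)) (pt : Z → NegaRing F n) :
    orbitCount G (Set.range pt) = (Set.range fun z => MulAction.orbit G (pt z)).ncard := by
  rw [orbitCount]
  congr 1
  ext O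
  constructor
  · rintro ⟨_, ⟨z, rfl⟩, rfl⟩; exact ⟨z, rfl⟩
  · rintro ⟨z, rfl⟩; exact ⟨_, ⟨z, rfl⟩, rfl⟩

/-- A code whose words are determined by a pair of coordinates in `{0} ∪ ⟨θ⟩`, on which the
negation multiplier, the Frobenius multiplier, the shift and the scalar act as expected. -/
structure IsPairCode {F : Type*} [Field F] {n : ℕ} {K : Type*} [Field K] (C : Set (NegaRing F n))
    (ev ev' : NegaRing F n → K) (f r s : NegaRing F n ≃ₗ[F] NegaRing F n)
    (β x θ : Kˣ) (q k M E : ℕ) : Prop where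
  one_lt : 1 < q
  ne_zero : k ≠ 0
  order : orderOf θ = q ^ k - 1
  dvd : E ∣ q ^ k - 1
  exists_root_eq : ∃ c : ℤ, β = θ ^ (M * c)
  exists_eq_root_pow : ∀ c : ℤ, ∃ w : ℕ, θ ^ (M * c) = β ^ w
  exists_scalar_eq : ∃ c : ℤ, x = θ ^ (E * c)
  exists_eq_scalar_pow : ∀ c : ℤ, ∃ w : ℕ, θ ^ (E * c) = x ^ w
  frob_mem : ∀ c ∈ C, f c ∈ C
  shift_mem : ∀ c ∈ C, r c ∈ C
  scalar_mem : ∀ c ∈ C, s c ∈ C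
  ev_frob : ∀ c, ev (f c) = ev c ^ q
  ev'_frob : ∀ c, ev' (f c) = ev' c ^ q
  ev_shift : ∀ c, ev (r c) = β * ev c
  ev'_shift : ∀ c, ev' (r c) = (β⁻¹ : Kˣ) * ev' c
  ev_scalar : ∀ c, ev (s c) = x * ev c
  ev'_scalar : ∀ c, ev' (s c) = x * ev' c
  inj : ∀ c ∈ C, ∀ c' ∈ C, ev c = ev c' → ev' c = ev' c' → c = c'
  mem : ∀ c ∈ C, ev c = 0 ∨ ∃ i : ℤ, ev c = (θ ^ i : Kˣ)
  mem' : ∀ c ∈ C, ev' c = 0 ∨ ∃ i : ℤ, ev' c = (θ ^ i : Kˣ)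
  surj : ∀ u v : K, (u = 0 ∨ ∃ i : ℤ, u = (θ ^ i : Kˣ)) → (v = 0 ∨ ∃ i : ℤ, v = (θ ^ i : Kˣ)) →
    ∃ c ∈ C, ev c = u ∧ ev' c = v

namespace IsPairCode

variable {F : Type*} [Field F] {n : ℕ} {K : Type*} [Field K] {C : Set (NegaRing F n)}
    {ev ev' : NegaRing F n → K} {μ f r s : NegaRing F n ≃ₗ[F] NegaRing F n}
    {β x θ : Kˣ} {q k M E : ℕ}

/-- Exchanging the coordinates replaces β by β⁻¹ and leaves M and E alone, so each statement about
the first coordinate transfers to the second. -/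
lemma symm (H : IsPairCode C ev ev' f r s β x θ q k M E) :
    IsPairCode C ev' ev f r s β⁻¹ x θ q k M E where
  __ := H
  exists_root_eq := by
    obtain ⟨c, hc⟩ := H.exists_root_eq
    exact ⟨-c, by rw [hc, mul_neg, zpow_neg]⟩
  exists_eq_root_pow := by
    intro c
    obtain ⟨w, hw⟩ := H.exists_eq_root_pow (-c)
    exact ⟨w, by rw [inv_pow, ← hw, mul_neg, zpow_neg, inv_inv]⟩
  ev_frob := H.ev'_frob
  ev'_frob := H.ev_frob
  ev_shift := H.ev'_shift
  ev'_shift := by rw [inv_inv]; exact H.ev_shift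
  ev_scalar := H.ev'_scalar
  ev'_scalar := H.ev_scalar
  inj := fun c hc c' hc' h h' => H.inj c hc c' hc' h' h
  mem := H.mem'
  mem' := H.mem
  surj := fun u v hu hv => by
    obtain ⟨c, hc, h1, h2⟩ := H.surj v u hv hu
    exact ⟨c, hc, h2, h1⟩

variable (H : IsPairCode C ev ev' f r s β x θ q k M E)
include H

lemma frob_pow_sub_mem (m : ℕ) (hkm : k ∣ m) : ((q ^ k - 1 : ℕ) : ℤ) ∣ (q : ℤ) ^ m - 1 := by
  obtain ⟨d, rfl⟩ := hkm
  have h := Nat.sub_dvd_pow_sub_pow (q ^ k) 1 d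
  rw [one_pow, ← pow_mul] at h
  have h2 := Int.natCast_dvd_natCast.mpr h
  rwa [Nat.cast_sub (Nat.one_le_pow _ _ H.one_lt.le) (n := q ^ (k * d)), Nat.cast_pow, Nat.cast_one] at h2

lemma order_pos : q ^ k - 1 ≠ 0 := by
  have := Nat.one_lt_pow H.ne_zero H.one_lt
  omega

lemma zpow_eq_iff (i j : ℤ) : ((θ ^ i : Kˣ) : K) = (θ ^ j : Kˣ) ↔ ((q ^ k - 1 : ℕ) : ℤ) ∣ i - j := by
  rw [Units.val_inj, ← H.order, ← orderOf_dvd_sub_iff_zpow_eq_zpow]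

lemma ev_shift_pow_scalar_pow (w v : ℕ) (c : NegaRing F n) :
    ev ((r ^ w * s ^ v) c) = (β ^ w * x ^ v : Kˣ) * ev c := by
  have h1 : ∀ w c, ev ((r ^ w) c) = (β ^ w : Kˣ) * ev c := by
    intro w
    induction w with
    | zero => intro c; simp
    | succ w ih =>
      intro c
      rw [pow_succ, LinearEquiv.mul_apply, ih, H.ev_shift, pow_succ]
      push_cast; ring
  have h2 : ∀ w c, ev ((s ^ w) c) = (x ^ w : Kˣ) * ev c := by
    intro w
    induction w with
    | zero => intro c; simp
    | succ w ih =>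
      intro c
      rw [pow_succ, LinearEquiv.mul_apply, ih, H.ev_scalar, pow_succ]
      push_cast; ring
  rw [LinearEquiv.mul_apply, h1, h2]
  push_cast; ring

lemma shift_pow_scalar_pow_mem (w v : ℕ) {c : NegaRing F n} (hc : c ∈ C) :
    (r ^ w * s ^ v) c ∈ C := by
  have h1 : ∀ w, ∀ c ∈ C, (r ^ w) c ∈ C := by
    intro w
    induction w with
    | zero => exact fun c hc => hc
    | succ w ih =>
      intro c hc
      rw [pow_succ, LinearEquiv.mul_apply]
      exact ih _ (H.shift_mem c hc)
  have h2 : ∀ w, ∀ c ∈ C, (s ^ w) c ∈ C := by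
    intro w
    induction w with
    | zero => exact fun c hc => hc
    | succ w ih =>
      intro c hc
      rw [pow_succ, LinearEquiv.mul_apply]
      exact ih _ (H.scalar_mem c hc)
  exact h1 _ _ (h2 _ _ hc)

/-- On logarithms, shifts and scalars translate by the multiples of D = gcd(E, M). As D divides q^k
- 1, this lattice already contains the periods of θ, and only multiplication by q remains on ℤ/D. -/
lemma orbitCount_axis [Finite (NegaRing F n ≃ₗ[F] NegaRing F n)] :
    k * orbitCount (Subgroup.closure {f, r, s}) {c | c ∈ C ∧ ev c ≠ 0 ∧ ev' c = 0} =
      ∑ h ∈ Finset.range k, Nat.gcd (q ^ Nat.gcd k h - 1) (Nat.gcd E M) := by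
  set D := Nat.gcd E M with hD
  have hDE : D ∣ E := Nat.gcd_dvd_left E M
  have hDM : D ∣ M := Nat.gcd_dvd_right E M
  clear_value D
  set G := Subgroup.closure {f, r, s} with hG
  have hDQ : D ∣ q ^ k - 1 := hDE.trans H.dvd
  have hDQ' : (D : ℤ) ∣ ((q ^ k - 1 : ℕ) : ℤ) := Int.natCast_dvd_natCast.mpr hDQ
  have hD0 : D ≠ 0 := fun h => H.order_pos (Nat.eq_zero_of_zero_dvd (h ▸ hDQ))
  choose pt hptC hev hev' using fun z : ℤ =>
    H.surj (θ ^ z : Kˣ) 0 (Or.inr ⟨z, rfl⟩) (Or.inl rfl)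
  have hrange : {c | c ∈ C ∧ ev c ≠ 0 ∧ ev' c = 0} = Set.range pt := by
    ext c
    constructor
    · rintro ⟨hc, h1, h2⟩
      obtain ⟨i, hi⟩ := (H.mem c hc).resolve_left h1
      exact ⟨i, H.inj _ (hptC i) _ hc ((hev i).trans hi.symm) ((hev' i).trans h2.symm)⟩
    · rintro ⟨i, rfl⟩
      exact ⟨hptC i, by rw [hev]; exact Units.ne_zero _, hev' i⟩
  have hpt : ∀ c ∈ C, ∀ z, ev c = (θ ^ z : Kˣ) → ev' c = 0 → c = pt z := fun c hc z h1 h2 =>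
    H.inj c hc _ (hptC z) (h1.trans (hev z).symm) (h2.trans (hev' z).symm)
  have hmemf : f ∈ G := Subgroup.subset_closure (by simp)
  have hmemr : r ∈ G := Subgroup.subset_closure (by simp)
  have hmems : s ∈ G := Subgroup.subset_closure (by simp)
  have hfpt : ∀ z, f (pt z) = pt (mulEnd ℤ q z) := by
    intro z
    have e := mulEnd_pow_apply q 1 z
    rw [pow_one, pow_one] at e
    refine hpt _ (H.frob_mem _ (hptC z)) _ ?_ ?_
    · rw [H.ev_frob, hev, e, nsmul_eq_mul, mul_comm, zpow_mul, zpow_natCast]; push_cast; rfl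
    · rw [H.ev'_frob, hev', zero_pow (by have := H.one_lt; omega)]
  have hcount : orbitCount G {c | c ∈ C ∧ ev c ≠ 0 ∧ ev' c = 0} =
      (Set.range fun z => MulAction.orbit G (pt z)).ncard := by
    rw [hrange, orbitCount_range]
  -- The involution is taken trivial, so every Burnside term occurs twice and the factor 2 cancels
  -- at the end.
  have hmain := two_mul_card_orbits {f, r, s} pt (AddSubgroup.zmultiples (D : ℤ))
    (by rw [Int.index_zmultiples]; simpa using hD0) (mulEnd ℤ q) 1 H.ne_zero
    (by
      intro z hz
      rw [Int.mem_zmultiples_iff] at hz ⊢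
      have e := mulEnd_pow_apply q 1 z
      rw [pow_one, pow_one] at e
      rw [e, nsmul_eq_mul]; exact hz.mul_left _)
    (fun z hz => hz)
    (by
      intro z
      rw [Int.mem_zmultiples_iff, mulEnd_pow_apply, nsmul_eq_mul]
      refine hDQ'.trans ((H.frob_pow_sub_mem k dvd_rfl).trans ?_)
      exact ⟨z, by push_cast; ring⟩)
    (one_pow 2) (Commute.one_left _)
    (by
      intro g hg z
      rcases hg with rfl | rfl | rfl
      · refine ⟨0, 1, 0, AddSubgroup.zero_mem _, ?_⟩
        rw [pow_zero, one_mul, pow_one, add_zero]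
        exact hfpt z
      · obtain ⟨c, hc⟩ := H.exists_root_eq
        refine ⟨0, 0, M * c, ?_, ?_⟩
        · rw [Int.mem_zmultiples_iff]
          exact (Int.natCast_dvd_natCast.mpr hDM).mul_right _
        · refine hpt _ (H.shift_mem _ (hptC z)) _ ?_ ?_
          · rw [H.ev_shift, hev, hc, ← Units.val_mul, ← zpow_add, add_comm]; rfl
          · rw [H.ev'_shift, hev', mul_zero]
      · obtain ⟨c, hc⟩ := H.exists_scalar_eq
        refine ⟨0, 0, E * c, ?_, ?_⟩
        · rw [Int.mem_zmultiples_iff]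
          exact (Int.natCast_dvd_natCast.mpr hDE).mul_right _
        · refine hpt _ (H.scalar_mem _ (hptC z)) _ ?_ ?_
          · rw [H.ev_scalar, hev, hc, ← Units.val_mul, ← zpow_add, add_comm]; rfl
          · rw [H.ev'_scalar, hev', mul_zero])
    (by
      intro l hl z
      rw [Int.mem_zmultiples_iff, hD, ← Int.gcd_natCast_natCast, Int.gcd_dvd_iff_exists] at hl
      obtain ⟨u, v, rfl⟩ := hl
      obtain ⟨w₁, h₁⟩ := H.exists_eq_root_pow v
      obtain ⟨w₂, h₂⟩ := H.exists_eq_scalar_pow u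
      refine ⟨⟨r ^ w₁ * s ^ w₂, mul_mem (pow_mem hmemr _) (pow_mem hmems _)⟩, ?_⟩
      refine hpt _ (H.shift_pow_scalar_pow_mem _ _ (hptC z)) _ ?_ ?_
      · rw [H.ev_shift_pow_scalar_pow, hev, ← h₁, ← h₂, ← Units.val_mul, ← zpow_add, ← zpow_add]
        congr 2; ring
      · rw [H.symm.ev_shift_pow_scalar_pow, hev', mul_zero])
    (fun z => ⟨⟨f, hmemf⟩, hfpt z⟩)
    (fun z => MulAction.mem_orbit_self _)
    (by
      intro z z' h
      rw [Int.mem_zmultiples_iff]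
      refine hDQ'.trans ((H.zpow_eq_iff z z').mp ?_)
      rw [← hev, ← hev, h])
  rw [← hG, ← hcount] at hmain
  have hq0 : 0 < q := by have := H.one_lt; omega
  have hsum : ∀ h ∈ Finset.range k,
      ((AddSubgroup.zmultiples (D : ℤ) ⊔ AddMonoidHom.range (mulEnd ℤ q ^ h - 1 : AddMonoid.End ℤ)).index +
        (AddSubgroup.zmultiples (D : ℤ) ⊔ AddMonoidHom.range (1 * mulEnd ℤ q ^ h - 1 : AddMonoid.End ℤ)).index) =
      2 * Nat.gcd (q ^ Nat.gcd k h - 1) D := by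
    intro h _
    rw [one_mul, index_zmultiples_sup_range _ _ _ hq0, ← Nat.pow_sub_one_gcd_pow_sub_one,
      Nat.gcd_comm _ D, ← Nat.gcd_assoc, Nat.gcd_eq_left hDQ]
    ring
  rw [Finset.sum_congr rfl hsum, ← Finset.mul_sum, mul_assoc] at hmain
  exact Nat.eq_of_mul_eq_mul_left two_pos hmain

omit H in
/-- The automorphism `g` exchanges the two coordinates and preserves the code. -/
def IsSwap (C : Set (NegaRing F n)) (ev ev' : NegaRing F n → K)
    (g : NegaRing F n ≃ₗ[F] NegaRing F n) : Prop :=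
  ∀ c, ev (g c) = ev' c ∧ ev' (g c) = ev c ∧ (c ∈ C → g c ∈ C)

/-- One computation covers both groups: σ is the identity without μ_{-1} and the exchange with it.
The sum may run up to any nonzero multiple m of k, because q^m ≡ 1 modulo q^k - 1. -/
lemma two_mul_orbitCount_torus [Finite (NegaRing F n ≃ₗ[F] NegaRing F n)]
    {m : ℕ} (hm : m ≠ 0) (hkm : k ∣ m) (T : Set (NegaRing F n ≃ₗ[F] NegaRing F n))
    (σ : AddMonoid.End (ℤ × ℤ)) (hfT : f ∈ T) (hrT : r ∈ T) (hsT : s ∈ T)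
    (hT : ∀ g ∈ T, g = f ∨ g = r ∨ g = s ∨ (IsSwap C ev ev' g ∧ σ = swapEnd))
    (hσ : σ = 1 ∨ (σ = swapEnd ∧ ∃ g ∈ T, IsSwap C ev ev' g)) :
    2 * m * orbitCount (Subgroup.closure T) {c | c ∈ C ∧ ev c ≠ 0 ∧ ev' c ≠ 0} =
      ∑ h ∈ Finset.range m,
        (Nat.gcd ((q ^ Nat.gcd k h - 1) * Nat.gcd (q ^ Nat.gcd k h - 1) (Nat.gcd E M)) (2 * (M * E)) +
          (twistLattice (q ^ k - 1 : ℕ) M E ⊔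
            AddMonoidHom.range (σ * mulEnd (ℤ × ℤ) q ^ h - 1 : AddMonoid.End (ℤ × ℤ))).index) := by
  set Λ := twistLattice (q ^ k - 1 : ℕ) M E with hΛ
  set G := Subgroup.closure T with hG
  have hq0 : 0 < q := by have := H.one_lt; omega
  choose pt hptC hev hev' using fun z : ℤ × ℤ =>
    H.surj (θ ^ z.1 : Kˣ) (θ ^ z.2 : Kˣ) (Or.inr ⟨z.1, rfl⟩) (Or.inr ⟨z.2, rfl⟩)
  have hrange : {c | c ∈ C ∧ ev c ≠ 0 ∧ ev' c ≠ 0} = Set.range pt := by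
    ext c
    constructor
    · rintro ⟨hc, h1, h2⟩
      obtain ⟨i, hi⟩ := (H.mem c hc).resolve_left h1
      obtain ⟨j, hj⟩ := (H.mem' c hc).resolve_left h2
      exact ⟨(i, j), H.inj _ (hptC _) _ hc ((hev _).trans hi.symm) ((hev' _).trans hj.symm)⟩
    · rintro ⟨i, rfl⟩
      exact ⟨hptC i, by rw [hev]; exact Units.ne_zero _, by rw [hev']; exact Units.ne_zero _⟩
  have hpt : ∀ c ∈ C, ∀ z : ℤ × ℤ, ev c = (θ ^ z.1 : Kˣ) → ev' c = (θ ^ z.2 : Kˣ) → c = pt z :=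
    fun c hc z h1 h2 => H.inj c hc _ (hptC z) (h1.trans (hev z).symm) (h2.trans (hev' z).symm)
  have hmul : ∀ z : ℤ × ℤ, mulEnd (ℤ × ℤ) q z = (z.1 * q, z.2 * q) := by
    intro z
    have e := mulEnd_pow_apply q 1 z
    rw [pow_one, pow_one] at e
    rw [e]
    ext <;> simp [mul_comm]
  have hfpt : ∀ z, f (pt z) = pt (mulEnd (ℤ × ℤ) q z) := by
    intro z
    refine hpt _ (H.frob_mem _ (hptC z)) _ ?_ ?_
    · rw [H.ev_frob, hev, hmul, zpow_mul, zpow_natCast]; push_cast; rfl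
    · rw [H.ev'_frob, hev', hmul, zpow_mul, zpow_natCast]; push_cast; rfl
  have hswap : ∀ g, IsSwap C ev ev' g → ∀ z, g (pt z) = pt (swapEnd z) := by
    intro g hg z
    obtain ⟨h1, h2, h3⟩ := hg (pt z)
    exact hpt _ (h3 (hptC z)) _ (h1.trans (hev' z)) (h2.trans (hev z))
  have hcount : orbitCount G {c | c ∈ C ∧ ev c ≠ 0 ∧ ev' c ≠ 0} =
      (Set.range fun z => MulAction.orbit G (pt z)).ncard := by
    rw [hrange, orbitCount_range]
  have hmain := two_mul_card_orbits T pt Λ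
    (by
      rw [hΛ, index_twistLattice _ _ _ H.order_pos]
      refine (Nat.gcd_pos_of_pos_left _ (Nat.mul_pos ?_ (Nat.gcd_pos_of_pos_left _ ?_))).ne' <;>
      exact Nat.pos_of_ne_zero H.order_pos) (mulEnd (ℤ × ℤ) q) σ hm
    (by
      rintro _ ⟨a, b, c, d, rfl⟩
      rw [hmul]
      exact ⟨a * q, b * q, c * q, d * q, by ext <;> simp <;> ring⟩)
    (by
      rcases hσ with rfl | ⟨rfl, -⟩
      · exact fun z hz => hz
      · rintro _ ⟨a, b, c, d, rfl⟩
        exact ⟨b, a, -c, d, by rw [swapEnd_apply]; ext <;> simp <;> ring⟩)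
    (by
      intro z
      obtain ⟨u, hu⟩ := H.frob_pow_sub_mem m hkm
      rw [mulEnd_pow_apply]
      refine ⟨u * z.1, u * z.2, 0, 0, ?_⟩
      ext
      · simp; linear_combination z.1 * hu
      · simp; linear_combination z.2 * hu)
    (by
      rcases hσ with rfl | ⟨rfl, -⟩
      · exact one_pow 2
      · rfl)
    (by
      rcases hσ with rfl | ⟨rfl, -⟩
      · exact Commute.one_left _
      · ext z <;> simp [hmul, swapEnd_apply])
    (by
      intro g hg z
      rcases hT g hg with rfl | rfl | rfl | ⟨hgs, rfl⟩
      · refine ⟨0, 1, 0, AddSubgroup.zero_mem _, ?_⟩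
        rw [pow_zero, one_mul, pow_one, add_zero]
        exact hfpt z
      · obtain ⟨c, hc⟩ := H.exists_root_eq
        refine ⟨0, 0, (M * c, -(M * c)), ⟨0, 0, c, 0, by ext <;> simp <;> ring⟩, ?_⟩
        refine hpt _ (H.shift_mem _ (hptC z)) _ ?_ ?_
        · rw [H.ev_shift, hev, hc, ← Units.val_mul, ← zpow_add, add_comm]; rfl
        · rw [H.ev'_shift, hev', hc, ← Units.val_mul, ← zpow_neg, ← zpow_add, add_comm]; rfl
      · obtain ⟨c, hc⟩ := H.exists_scalar_eq
        refine ⟨0, 0, (E * c, E * c), ⟨0, 0, 0, c, by ext <;> simp <;> ring⟩, ?_⟩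
        refine hpt _ (H.scalar_mem _ (hptC z)) _ ?_ ?_
        · rw [H.ev_scalar, hev, hc, ← Units.val_mul, ← zpow_add, add_comm]; rfl
        · rw [H.ev'_scalar, hev', hc, ← Units.val_mul, ← zpow_add, add_comm]; rfl
      · refine ⟨1, 0, 0, AddSubgroup.zero_mem _, ?_⟩
        rw [pow_zero, mul_one, pow_one, add_zero]
        exact hswap g hgs z)
    (by
      rintro _ ⟨a, b, c, d, rfl⟩ z
      obtain ⟨w₁, h₁⟩ := H.exists_eq_root_pow c
      obtain ⟨w₂, h₂⟩ := H.exists_eq_scalar_pow d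
      refine ⟨⟨r ^ w₁ * s ^ w₂, mul_mem (pow_mem (Subgroup.subset_closure hrT) _)
        (pow_mem (Subgroup.subset_closure hsT) _)⟩, ?_⟩
      refine hpt _ (H.shift_pow_scalar_pow_mem _ _ (hptC z)) _ ?_ ?_
      · rw [H.ev_shift_pow_scalar_pow, hev, ← h₁, ← h₂, ← Units.val_mul, ← zpow_add, ← zpow_add,
          H.zpow_eq_iff]
        exact ⟨-a, by simp only [Prod.fst_add]; ring⟩
      · rw [H.symm.ev_shift_pow_scalar_pow, hev', inv_pow, ← h₁, ← h₂, ← Units.val_mul, ← zpow_neg,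
          ← zpow_add, ← zpow_add, H.zpow_eq_iff]
        exact ⟨-b, by simp only [Prod.snd_add]; ring⟩)
    (fun z => ⟨⟨f, Subgroup.subset_closure hfT⟩, hfpt z⟩)
    (by
      rcases hσ with rfl | ⟨rfl, g, hg, hgs⟩
      · exact fun z => MulAction.mem_orbit_self _
      · exact fun z => ⟨⟨g, Subgroup.subset_closure hg⟩, hswap g hgs z⟩)
    (by
      intro z z' h
      obtain ⟨a, ha⟩ := (H.zpow_eq_iff z.1 z'.1).mp (by rw [← hev, ← hev, h])
      obtain ⟨b, hb⟩ := (H.zpow_eq_iff z.2 z'.2).mp (by rw [← hev', ← hev', h])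
      refine ⟨a, b, 0, 0, ?_⟩
      ext
      · simp only [Prod.fst_sub]; linear_combination ha
      · simp only [Prod.snd_sub]; linear_combination hb)
  rw [← hG, ← hcount] at hmain
  rw [hmain]
  refine Finset.sum_congr rfl fun h _ => ?_
  congr 1
  have h0 : Nat.gcd (q ^ k - 1) (q ^ h - 1) ≠ 0 :=
    (Nat.gcd_pos_of_pos_left _ (Nat.pos_of_ne_zero H.order_pos)).ne'
  rw [hΛ, twistLattice_sup_range _ _ _ _ _ hq0, index_twistLattice _ _ _ h0,
    Nat.pow_sub_one_gcd_pow_sub_one]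

lemma orbitCount_torus [Finite (NegaRing F n ≃ₗ[F] NegaRing F n)] :
    k * orbitCount (Subgroup.closure {f, r, s}) {c | c ∈ C ∧ ev c ≠ 0 ∧ ev' c ≠ 0} =
      ∑ h ∈ Finset.range k, Nat.gcd ((q ^ Nat.gcd k h - 1) *
        Nat.gcd (q ^ Nat.gcd k h - 1) (Nat.gcd E M)) (2 * (M * E)) := by
  have hq0 : 0 < q := by have := H.one_lt; omega
  have h := H.two_mul_orbitCount_torus H.ne_zero dvd_rfl {f, r, s} 1 (by simp) (by simp) (by simp)
    (by
      rintro g (rfl | rfl | rfl)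
      · exact Or.inl rfl
      · exact Or.inr (Or.inl rfl)
      · exact Or.inr (Or.inr (Or.inl rfl))) (Or.inl rfl)
  refine Nat.eq_of_mul_eq_mul_left two_pos ?_
  rw [← mul_assoc, h, Finset.mul_sum]
  refine Finset.sum_congr rfl fun i _ => ?_
  have h0 : Nat.gcd (q ^ k - 1) (q ^ i - 1) ≠ 0 :=
    (Nat.gcd_pos_of_pos_left _ (Nat.pos_of_ne_zero H.order_pos)).ne'
  rw [one_mul, twistLattice_sup_range _ _ _ _ _ hq0, index_twistLattice _ _ _ h0,
    Nat.pow_sub_one_gcd_pow_sub_one]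
  ring

lemma orbitCount_torus_swap [Finite (NegaRing F n ≃ₗ[F] NegaRing F n)]
    {m : ℕ} (hm : m ≠ 0) (hkm : k ∣ m) (hμ : IsSwap C ev ev' μ) :
    2 * m * orbitCount (Subgroup.closure {μ, f, r, s}) {c | c ∈ C ∧ ev c ≠ 0 ∧ ev' c ≠ 0} =
      ∑ h ∈ Finset.range m, (Nat.gcd ((q ^ Nat.gcd k h - 1) *
        Nat.gcd (q ^ Nat.gcd k h - 1) (Nat.gcd E M)) (2 * (M * E)) +
        Nat.gcd (q ^ Nat.gcd k (2 * h) - 1) (Nat.gcd ((q ^ h + 1) * E) ((q ^ h - 1) * M))) := by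
  have hq0 : 0 < q := by have := H.one_lt; omega
  rw [H.two_mul_orbitCount_torus hm hkm {μ, f, r, s} swapEnd (by simp) (by simp) (by simp)
    (by
      rintro g (rfl | rfl | rfl | rfl)
      · exact Or.inr (Or.inr (Or.inr ⟨hμ, rfl⟩))
      · exact Or.inl rfl
      · exact Or.inr (Or.inl rfl)
      · exact Or.inr (Or.inr (Or.inl rfl))) (Or.inr ⟨rfl, μ, by simp, hμ⟩)]
  refine Finset.sum_congr rfl fun i _ => ?_
  rw [index_twistLattice_sup_swap_range _ _ _ _ _ hq0, Nat.pow_sub_one_gcd_pow_sub_one]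

end IsPairCode
end NegaRing

/-! ### The code of the theorem as a pair code -/

namespace NegaRing

/-- With Q the order of θ, the exponent Q/gcd(N, Q) kills θ^N, hence also θ^j. This forces gcd(N, Q)
∣ j, so θ^j is a power of θ^N. -/
lemma exists_zpow_eq_of_forall_eq_one {G : Type*} [Group G] {θ : G} (hθ : IsOfFinOrder θ)
    {N j : ℤ} (h : ∀ i : ℤ, θ ^ (N * i) = 1 → θ ^ (j * i) = 1) : ∃ c : ℤ, θ ^ j = θ ^ (N * c) := by
  have hQ : (orderOf θ : ℤ) ≠ 0 := by exact_mod_cast hθ.orderOf_pos.ne'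
  obtain ⟨t, ht⟩ : ((Int.gcd N (orderOf θ) : ℕ) : ℤ) ∣ orderOf θ := Int.gcd_dvd_right ..
  obtain ⟨N', hN'⟩ : ((Int.gcd N (orderOf θ) : ℕ) : ℤ) ∣ N := Int.gcd_dvd_left ..
  have ht0 : t ≠ 0 := by rintro rfl; rw [mul_zero] at ht; exact hQ ht
  have h1 := h t (orderOf_dvd_iff_zpow_eq_one.mp ⟨N', by
    rw [hN']; linear_combination -N' * ht⟩)
  rw [← orderOf_dvd_iff_zpow_eq_one, ht] at h1
  obtain ⟨u, v, huv⟩ := (Int.gcd_dvd_iff_exists _ _ _).mp (Int.dvd_of_mul_dvd_mul_right ht0 h1)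
  refine ⟨u, ?_⟩
  rw [huv, zpow_add, mul_comm v, zpow_mul θ (orderOf θ : ℤ), zpow_natCast, pow_orderOf_eq_one,
    one_zpow, mul_one, mul_comm]

/-- In a finite cyclic group, elements with the same annihilating exponents generate the same
subgroup. So M and E can replace the true logarithms of β and ξ, which depend on the choice of θ.
Finite order makes the exponent w nonnegative. -/
lemma exists_zpow_eq_and_forall_exists_pow_eq {G : Type*} [Group G] {θ y : G}
    (hθ : IsOfFinOrder θ) (hy : ∃ j : ℤ, y = θ ^ j) {N : ℕ}
    (h : ∀ i : ℤ, y ^ i = 1 ↔ θ ^ (N * i) = 1) :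
    (∃ c : ℤ, y = θ ^ (N * c)) ∧ ∀ c : ℤ, ∃ w : ℕ, θ ^ (N * c) = y ^ w := by
  obtain ⟨j, rfl⟩ := hy
  refine ⟨exists_zpow_eq_of_forall_eq_one hθ fun i hi => by rw [zpow_mul]; exact (h i).mpr hi, ?_⟩
  intro c
  obtain ⟨d, hd⟩ := exists_zpow_eq_of_forall_eq_one hθ (N := j) (j := N)
    fun i hi => by rw [zpow_mul] at hi; exact (h i).mp hi
  have hfin : IsOfFinOrder (θ ^ j) := hθ.zpow
  have : θ ^ (N * c) ∈ Subgroup.zpowers (θ ^ j) := by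
    rw [zpow_mul, hd, zpow_mul θ j d, ← zpow_mul]
    exact ⟨d * c, rfl⟩
  obtain ⟨w, hw⟩ := hfin.mem_powers_iff_mem_zpowers.mpr this
  exact ⟨w, hw.symm⟩

section Code

variable {F : Type*} [Field F] [Fintype F] {K : Type*} [Field K] [Algebra F K] {n : ℕ} [NeZero n]
  (hq : Odd (Fintype.card F)) (hn : n.Coprime (Fintype.card F)) {ζ : K}
  (hζ : IsPrimitiveRoot ζ (2 * n)) (a : ℕ)

lemma muNegOne_muNegOne (F : Type*) [Field F] (n : ℕ) [NeZero n] (c : NegaRing F n) :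
    muNegOne F n (muNegOne F n c) = c := by
  have : muNegOne F n ^ 2 = 1 := multiplier_pow_eq_one F n _ _ _ (by simp)
  rw [← LinearEquiv.mul_apply, ← sq, this]; rfl

lemma multiplier_mem_irreducibleCode {c : NegaRing F n}
    (hc : c ∈ irreducibleCode F n hq hn hζ (1 + 2 * a)) :
    muQ F n hq hn c ∈ irreducibleCode F n hq hn hζ (1 + 2 * a) := by
  rw [mem_irreducibleCode_iff] at hc ⊢
  intro y hy h
  have hyq : (y ^ (Fintype.card F ^ 1)) ^ n = -1 := by
    rw [pow_one]; exact pow_pow_eq_neg_one hy hq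
  have e : y ^ ((Fintype.card F : ℕ) : ℤ) = y ^ (Fintype.card F ^ 1) := by
    rw [zpow_natCast, pow_one]
  rw [muQ, evalAt_multiplier _ hy (by rw [e]; exact hyq), evalAt_congr e _ hyq,
    evalAt_pow_card hy, hc y hy h, zero_pow (pow_ne_zero _ Fintype.card_ne_zero)]

lemma evalAt_muQ {y : K} (hy : y ^ n = -1) (c : NegaRing F n) :
    evalAt F hy (muQ F n hq hn c) = evalAt F hy c ^ Fintype.card F := by
  have hyq : (y ^ (Fintype.card F ^ 1)) ^ n = -1 := by
    rw [pow_one]; exact pow_pow_eq_neg_one hy hq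
  have e : y ^ ((Fintype.card F : ℕ) : ℤ) = y ^ (Fintype.card F ^ 1) := by
    rw [zpow_natCast, pow_one]
  rw [muQ, evalAt_multiplier _ hy (by rw [e]; exact hyq), evalAt_congr e _ hyq,
    evalAt_pow_card hy, pow_one]

lemma mul_mem_irreducibleCode (b : ZMod (2 * n)) {c : NegaRing F n} (r : NegaRing F n)
    (hc : c ∈ irreducibleCode F n hq hn hζ b) : r * c ∈ irreducibleCode F n hq hn hζ b :=
  Ideal.mul_mem_left _ r hc

/-- The code generated by the primitive idempotent and its image under `μ_{-1}`. -/
noncomputable def pairCode : Submodule F (NegaRing F n) :=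
  irreducibleCode F n hq hn hζ (1 + 2 * a) ⊔
    (irreducibleCode F n hq hn hζ (1 + 2 * a)).map (muNegOne F n).toLinearMap

lemma mem_pairCode {c : NegaRing F n} : c ∈ pairCode hq hn hζ a ↔
    ∃ u ∈ irreducibleCode F n hq hn hζ (1 + 2 * a), ∃ v ∈ irreducibleCode F n hq hn hζ (1 + 2 * a),
      c = u + muNegOne F n v := by
  rw [pairCode, Submodule.mem_sup]
  constructor
  · rintro ⟨u, hu, _, ⟨v, hv, rfl⟩, rfl⟩
    exact ⟨u, hu, v, hv, rfl⟩
  · rintro ⟨u, hu, v, hv, rfl⟩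
    exact ⟨u, hu, _, ⟨v, hv, rfl⟩, rfl⟩

lemma muNegOne_mem_pairCode {c : NegaRing F n} (hc : c ∈ pairCode hq hn hζ a) :
    muNegOne F n c ∈ pairCode hq hn hζ a := by
  obtain ⟨u, hu, v, hv, rfl⟩ := (mem_pairCode hq hn hζ a).mp hc
  exact (mem_pairCode hq hn hζ a).mpr ⟨v, hv, u, hu, by rw [map_add, muNegOne_muNegOne, add_comm]⟩

lemma muQ_mem_pairCode {c : NegaRing F n} (hc : c ∈ pairCode hq hn hζ a) :
    muQ F n hq hn c ∈ pairCode hq hn hζ a := by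
  obtain ⟨u, hu, v, hv, rfl⟩ := (mem_pairCode hq hn hζ a).mp hc
  refine (mem_pairCode hq hn hζ a).mpr ⟨_, multiplier_mem_irreducibleCode hq hn hζ a hu, _,
    multiplier_mem_irreducibleCode hq hn hζ a hv, ?_⟩
  rw [map_add]
  congr 1
  exact LinearEquiv.congr_fun (multiplier_comm F n _ _ _ _) v

lemma shift_mem_pairCode {c : NegaRing F n} (hc : c ∈ pairCode hq hn hζ a) :
    shift F n c ∈ pairCode hq hn hζ a := by
  obtain ⟨u, hu, v, hv, rfl⟩ := (mem_pairCode hq hn hζ a).mp hc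
  refine (mem_pairCode hq hn hζ a).mpr ⟨_, mul_mem_irreducibleCode hq hn hζ _ (x F n) hu, _,
    mul_mem_irreducibleCode hq hn hζ _ ((x F n)⁻¹ : (NegaRing F n)ˣ) hv, ?_⟩
  rw [map_add]
  congr 1
  have h := LinearEquiv.congr_fun (multiplier_shift F n (-1) isCoprime_one_left.neg_left)
    ((((x F n)⁻¹ : (NegaRing F n)ˣ) : NegaRing F n) * v)
  rw [LinearEquiv.mul_apply, LinearEquiv.mul_apply, shift_zpow_apply, shift_apply,
    Units.mul_inv_cancel_left] at h
  rw [shift_apply, muNegOne, h, zpow_neg_one, Units.mul_inv_cancel_left]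

lemma scalar_mem_pairCode (ξ : Fˣ) {c : NegaRing F n} (hc : c ∈ pairCode hq hn hζ a) :
    scalar F n ξ c ∈ pairCode hq hn hζ a :=
  Submodule.smul_mem _ _ hc

lemma map_pairCode {ξ : Fˣ} {g : NegaRing F n ≃ₗ[F] NegaRing F n}
    (hg : g ∈ groupNegQ F n hq hn ξ) :
    (pairCode hq hn hζ a).map g.toLinearMap = pairCode hq hn hζ a := by
  have hfin : Module.Finite F (NegaRing F n) := (monic_modulus F n).finite_adjoinRoot
  -- In finite dimension a stable subspace is mapped onto itself by an automorphism.
  have key : ∀ g : NegaRing F n ≃ₗ[F] NegaRing F n,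
      (∀ c ∈ pairCode hq hn hζ a, g c ∈ pairCode hq hn hζ a) →
      (pairCode hq hn hζ a).map g.toLinearMap = pairCode hq hn hζ a := by
    intro g hg
    refine Submodule.eq_of_le_of_finrank_eq ?_ (LinearEquiv.finrank_map_eq g _)
    rintro _ ⟨c, hc, rfl⟩
    exact hg c hc
  induction hg using Subgroup.closure_induction with
  | mem g hg =>
    apply key
    rcases hg with rfl | rfl | rfl | rfl
    · exact fun c hc => muNegOne_mem_pairCode hq hn hζ a hc
    · exact fun c hc => muQ_mem_pairCode hq hn hζ a hc
    · exact fun c hc => shift_mem_pairCode hq hn hζ a hc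
    · exact fun c hc => scalar_mem_pairCode hq hn hζ a ξ hc
  | one => exact Submodule.map_id _
  | mul g g' _ _ h h' =>
    have : (g * g').toLinearMap = g.toLinearMap ∘ₗ g'.toLinearMap := rfl
    rw [this, Submodule.map_comp, h', h]
  | inv g _ h =>
    apply key
    intro c hc
    rw [← h] at hc
    obtain ⟨b, hb, rfl⟩ := hc
    change (g⁻¹ * g) b ∈ _
    rw [inv_mul_cancel]
    exact hb

variable (hneg : -(1 + 2 * a : ZMod (2 * n)) ∉
  cyclotomicCoset (2 * n) (Fintype.card F) (1 + 2 * a))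

include hneg in
lemma evalAt_inv_eq_zero {c : NegaRing F n}
    (hc : c ∈ irreducibleCode F n hq hn hζ (1 + 2 * a)) :
    evalAt F (inv_pow_eq_neg_one (root_pow_eq_neg_one hζ a)) c = 0 :=
  (mem_irreducibleCode_iff hq hn hζ a c).mp hc _ _ (inv_root_ne_of_neg_notMem hζ a hneg)

lemma evalAt_inv_muNegOne {y : K} (hy : y ^ n = -1) (c : NegaRing F n) :
    evalAt F (inv_pow_eq_neg_one hy) (muNegOne F n c) = evalAt F hy c := by
  rw [evalAt_muNegOne]
  exact evalAt_congr (inv_inv y) _ _ c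

include hneg in
-- If c = μ_{-1}v lies in both summands, then c(β) = v(β⁻¹) = 0, and a word of the irreducible code
-- is determined by its value at β.
lemma disjoint_irreducibleCode_map : Disjoint (irreducibleCode F n hq hn hζ (1 + 2 * a))
    ((irreducibleCode F n hq hn hζ (1 + 2 * a)).map (muNegOne F n).toLinearMap) := by
  rw [Submodule.disjoint_def]
  rintro _ hc ⟨v, hv, rfl⟩
  refine eq_zero_of_mem_irreducibleCode hq hn hζ a hc ?_
  exact (evalAt_muNegOne _ v).trans (evalAt_inv_eq_zero hq hn hζ a hneg hv)

lemma isSwap_muNegOne : IsPairCode.IsSwap (pairCode hq hn hζ a : Set (NegaRing F n))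
    (evalAt F (root_pow_eq_neg_one hζ a))
    (evalAt F (inv_pow_eq_neg_one (root_pow_eq_neg_one hζ a))) (muNegOne F n) := fun c =>
  ⟨evalAt_muNegOne _ c, evalAt_inv_muNegOne _ c, fun hc => muNegOne_mem_pairCode hq hn hζ a hc⟩

include hneg in
-- With Q = q^k - 1, β^i = 1 means 2n ∣ (1+2a)i, that is Q ∣ Mi; and ξ^i = 1 means q - 1 ∣ i, that
-- is Q ∣ Ei. Injectivity and surjectivity of the two coordinates hold because each summand vanishes
-- at the root that reads the other.
lemma exists_isPairCode {ξ : Fˣ} (hξ : ∀ u : Fˣ, u ∈ Subgroup.zpowers ξ) {k : ℕ}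
    (hk : k = (cyclotomicCoset (2 * n) (Fintype.card F) (1 + 2 * a : ZMod (2 * n))).card) :
    2 * n ∣ (1 + 2 * a) * (Fintype.card F ^ k - 1) ∧ ∃ β x θ : Kˣ,
      IsPairCode (pairCode hq hn hζ a : Set (NegaRing F n)) (evalAt F (root_pow_eq_neg_one hζ a))
        (evalAt F (inv_pow_eq_neg_one (root_pow_eq_neg_one hζ a))) (muQ F n hq hn) (shift F n)
        (scalar F n ξ) β x θ (Fintype.card F) k
        ((1 + 2 * a) * (Fintype.card F ^ k - 1) / (2 * n))
        ((Fintype.card F ^ k - 1) / (Fintype.card F - 1)) := by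
  classical
  have hβ := root_pow_eq_neg_one hζ a
  have hβ0 : ζ ^ (1 + 2 * a) ≠ 0 := ne_zero_of_pow_eq_neg_one hβ
  have hqu : IsUnit ((Fintype.card F : ℕ) : ZMod (2 * n)) :=
    (ZMod.isUnit_iff_coprime _ _).mpr (Nat.isCoprime_iff_coprime.mp (isCoprime_card F n hq hn))
  obtain ⟨hk0, hkdvd⟩ := card_cyclotomicCoset_dvd_iff hqu (1 + 2 * a : ZMod (2 * n))
  rw [← hk] at hk0 hkdvd
  have hq1 : 1 < Fintype.card F := Fintype.one_lt_card
  have hQ1 : 1 < Fintype.card F ^ k := Nat.one_lt_pow hk0 hq1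
  obtain ⟨θ, hθ, hrange⟩ := exists_generator_range_evalAt (F := F) hβ hk0
    (fun i => (root_pow_pow_eq_self_iff hζ a i).trans (hkdvd i))
  have hθfin : IsOfFinOrder θ := by rw [← orderOf_pos_iff, hθ]; omega
  -- Since β^(q^k) = β, the exponent q^k - 1 kills β; this makes the division defining M exact.
  have h2n : 2 * n ∣ (1 + 2 * a) * (Fintype.card F ^ k - 1) := by
    apply hζ.dvd_of_pow_eq_one
    rw [pow_mul]
    apply mul_left_cancel₀ hβ0
    rw [← pow_succ', Nat.sub_add_cancel hQ1.le, mul_one]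
    exact (root_pow_pow_eq_self_iff hζ a k).mpr ((hkdvd k).mpr dvd_rfl)
  have hE : Fintype.card F - 1 ∣ Fintype.card F ^ k - 1 := by
    simpa using Nat.sub_dvd_pow_sub_pow (Fintype.card F) 1 k
  obtain ⟨M, hM⟩ := h2n
  obtain ⟨E, hE⟩ := hE
  have hMdiv : (1 + 2 * a) * (Fintype.card F ^ k - 1) / (2 * n) = M := by
    rw [hM, Nat.mul_div_cancel_left _ (by have := NeZero.pos n; omega)]
  have hEdiv : (Fintype.card F ^ k - 1) / (Fintype.card F - 1) = E := by
    rw [hE, Nat.mul_div_cancel_left _ (by omega)]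
  have hQ0 : ((Fintype.card F ^ k - 1 : ℕ) : ℤ) ≠ 0 := by
    have : Fintype.card F ^ k - 1 ≠ 0 := by omega
    exact_mod_cast this
  have h2n0 : ((2 * n : ℕ) : ℤ) ≠ 0 := by
    have : 2 * n ≠ 0 := by have := NeZero.ne n; omega
    exact_mod_cast this
  let β : Kˣ := Units.mk0 _ hβ0
  let x' : Kˣ := Units.map (algebraMap F K : F →* K) ξ
  have hβ' := exists_zpow_eq_and_forall_exists_pow_eq hθfin (y := β) (N := M)
    (by
      obtain ⟨i, hi⟩ := ((hrange _).mp ⟨_, evalAt_x hβ⟩).resolve_left hβ0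
      exact ⟨i, Units.ext hi⟩)
    (by
      intro i
      rw [← orderOf_dvd_iff_zpow_eq_one (x := θ), hθ]
      have h1 : β ^ i = 1 ↔ ((2 * n : ℕ) : ℤ) ∣ ((1 + 2 * a : ℕ) : ℤ) * i := by
        rw [← hζ.zpow_eq_one_iff_dvd, zpow_mul, zpow_natCast, ← Units.val_inj]
        simp [β]
      have hMI : (((1 + 2 * a : ℕ) : ℤ)) * ((Fintype.card F ^ k - 1 : ℕ) : ℤ) = ((2 * n : ℕ) : ℤ) * M := by
        exact_mod_cast hM
      rw [h1, ← mul_dvd_mul_iff_right hQ0, ← mul_dvd_mul_iff_left (a := ((2 * n : ℕ) : ℤ)) (c := M * i) h2n0,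
        ← mul_assoc _ (M : ℤ), ← hMI, mul_right_comm])
  have hx' := exists_zpow_eq_and_forall_exists_pow_eq hθfin (y := x') (N := E)
    (by
      obtain ⟨i, hi⟩ := ((hrange (algebraMap F K ξ)).mp ⟨algebraMap F _ ξ, AlgHom.commutes _ _⟩).resolve_left
        ((_root_.map_ne_zero _).mpr ξ.ne_zero)
      exact ⟨i, Units.ext hi⟩)
    (by
      intro i
      have h1 : x' ^ i = 1 ↔ ((Fintype.card F - 1 : ℕ) : ℤ) ∣ i := by
        have h2 : orderOf x' = orderOf ξ :=
          orderOf_injective _ (Units.map_injective (algebraMap F K).injective) ξ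
        rw [← orderOf_dvd_iff_zpow_eq_one, h2, orderOf_eq_card_of_forall_mem_zpowers hξ,
          Nat.card_eq_fintype_card, Fintype.card_units]
      have hE0 : (E : ℤ) ≠ 0 := by
        have : E ≠ 0 := by
          rintro rfl
          rw [mul_zero] at hE
          omega
        exact_mod_cast this
      rw [h1, ← orderOf_dvd_iff_zpow_eq_one, hθ, hE, mul_comm (_ - 1) E, Nat.cast_mul,
        mul_dvd_mul_iff_left hE0])
  have hev' : ∀ c, evalAt F (inv_pow_eq_neg_one hβ) c = evalAt F hβ (muNegOne F n c) :=
    fun c => (evalAt_muNegOne hβ c).symm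
  refine ⟨⟨M, hM⟩, β, x', θ, ?_⟩
  rw [hMdiv, hEdiv]
  exact
  { one_lt := hq1
    ne_zero := hk0
    order := hθ
    dvd := ⟨_, hE.trans (mul_comm _ _)⟩
    exists_root_eq := hβ'.1
    exists_eq_root_pow := hβ'.2
    exists_scalar_eq := hx'.1
    exists_eq_scalar_pow := hx'.2
    frob_mem := fun c hc => muQ_mem_pairCode hq hn hζ a hc
    shift_mem := fun c hc => shift_mem_pairCode hq hn hζ a hc
    scalar_mem := fun c hc => scalar_mem_pairCode hq hn hζ a ξ hc
    ev_frob := evalAt_muQ hq hn hβ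
    ev'_frob := evalAt_muQ hq hn _
    ev_shift := evalAt_shift hβ
    ev'_shift := fun c => by rw [evalAt_shift, Units.val_inv_eq_inv_val]; rfl
    ev_scalar := evalAt_scalar ξ hβ
    ev'_scalar := evalAt_scalar ξ _
    inj := by
      intro c hc c' hc' h h'
      obtain ⟨u, hu, v, hv, huv⟩ := (mem_pairCode hq hn hζ a).mp (Submodule.sub_mem _ hc hc')
      have h1 : evalAt F hβ u = 0 := by
        have := congrArg (evalAt F hβ) huv
        rwa [map_sub, h, sub_self, map_add, evalAt_muNegOne,
          evalAt_inv_eq_zero hq hn hζ a hneg hv, add_zero, eq_comm] at this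
      have h2 : evalAt F hβ v = 0 := by
        have := congrArg (evalAt F (inv_pow_eq_neg_one hβ)) huv
        rwa [map_sub, h', sub_self, map_add, evalAt_inv_muNegOne,
          evalAt_inv_eq_zero hq hn hζ a hneg hu, zero_add, eq_comm] at this
      rw [eq_zero_of_mem_irreducibleCode hq hn hζ a hu h1,
        eq_zero_of_mem_irreducibleCode hq hn hζ a hv h2, map_zero, add_zero] at huv
      exact sub_eq_zero.mp huv
    mem := fun c _ => (hrange _).mp ⟨c, rfl⟩
    mem' := fun c _ => (hrange _).mp ⟨_, (hev' c).symm⟩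
    surj := by
      intro u v hu hv
      obtain ⟨r₁, hr₁⟩ := (hrange u).mpr hu
      obtain ⟨r₂, hr₂⟩ := (hrange v).mpr hv
      obtain ⟨c₁, hc₁, h₁⟩ := exists_mem_irreducibleCode_evalAt_eq hq hn hζ a r₁
      obtain ⟨c₂, hc₂, h₂⟩ := exists_mem_irreducibleCode_evalAt_eq hq hn hζ a r₂
      refine ⟨c₁ + muNegOne F n c₂, (mem_pairCode hq hn hζ a).mpr ⟨c₁, hc₁, c₂, hc₂, rfl⟩, ?_, ?_⟩
      · rw [map_add, evalAt_muNegOne, evalAt_inv_eq_zero hq hn hζ a hneg hc₂, add_zero, h₁, hr₁]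
      · rw [map_add, evalAt_inv_muNegOne hβ, evalAt_inv_eq_zero hq hn hζ a hneg hc₁, zero_add, h₂, hr₂] }

end Code
end NegaRing

/-! ### Comparison of the orbits of the two groups -/

namespace NegaRing

section Orbits

variable {F : Type*} [Field F] {n : ℕ}

lemma orbitCount_eq_ncard_image (G : Subgroup (NegaRing F n ≃ₗ[F] NegaRing F n))
    (S : Set (NegaRing F n)) : orbitCount G S = ((fun c => MulAction.orbit G c) '' S).ncard := by
  rw [orbitCount]
  congr 1
  ext O
  exact exists_congr fun c => and_congr_right fun _ => eq_comm

lemma orbitCount_union [Finite (NegaRing F n)] (G : Subgroup (NegaRing F n ≃ₗ[F] NegaRing F n))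
    (S S' : Set (NegaRing F n)) (h : ∀ c ∈ S, ∀ g ∈ G, g c ∉ S') :
    orbitCount G (S ∪ S') = orbitCount G S + orbitCount G S' := by
  rw [orbitCount_eq_ncard_image, orbitCount_eq_ncard_image, orbitCount_eq_ncard_image,
    Set.image_union, Set.ncard_union_eq]
  rw [Set.disjoint_left]
  rintro _ ⟨c, hc, rfl⟩ ⟨c', hc', hcc'⟩
  obtain ⟨⟨g, hg⟩, rfl⟩ := MulAction.orbit_eq_iff.mp hcc'
  exact h c hc g hg hc'

end Orbits

section Pair

variable {F : Type*} [Field F] [Fintype F] {n : ℕ} [NeZero n] {K : Type*} [Field K]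
  {C : Set (NegaRing F n)} {ev ev' : NegaRing F n → K}
  (hq : Odd (Fintype.card F)) (hn : n.Coprime (Fintype.card F)) {ξ : Fˣ}
  {β x θ : Kˣ} {k M E : ℕ}

lemma groupQ_le_groupNegQ (ξ : Fˣ) : groupQ F n hq hn ξ ≤ groupNegQ F n hq hn ξ :=
  Subgroup.closure_mono (Set.subset_insert _ _)

lemma muNegOne_mem_groupNegQ (ξ : Fˣ) : muNegOne F n ∈ groupNegQ F n hq hn ξ :=
  Subgroup.subset_closure (by simp)

/-- In the normal form μ_{-1} occurs with exponent 0 or 1, and the remaining factors lie in the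
small group. -/
lemma exists_eq_muNegOne_pow_mul (hξ : ∀ u : Fˣ, u ∈ Subgroup.zpowers ξ)
    {g : NegaRing F n ≃ₗ[F] NegaRing F n} (hg : g ∈ groupNegQ F n hq hn ξ) :
    g ∈ groupQ F n hq hn ξ ∨ ∃ g' ∈ groupQ F n hq hn ξ, g = muNegOne F n * g' := by
  obtain ⟨j₀, j₁, j₂, j₃, h₀, -, -, -, rfl⟩ := exists_normalForm F n hq hn hξ hg
  have hmem : muQ F n hq hn ^ j₁ * shift F n ^ j₂ * scalar F n ξ ^ j₃ ∈ groupQ F n hq hn ξ :=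
    mul_mem (mul_mem (pow_mem (Subgroup.subset_closure (by simp)) _)
      (pow_mem (Subgroup.subset_closure (by simp)) _))
      (pow_mem (Subgroup.subset_closure (by simp)) _)
  interval_cases j₀
  · left
    rwa [pow_zero, one_mul]
  · right
    exact ⟨_, hmem, by rw [pow_one, mul_assoc, mul_assoc, mul_assoc]⟩

namespace IsPairCode

variable (H : IsPairCode C ev ev' (muQ F n hq hn) (shift F n) (scalar F n ξ) β x θ
  (Fintype.card F) k M E)
include H

lemma ev_eq_zero_iff {g : NegaRing F n ≃ₗ[F] NegaRing F n} (hg : g ∈ groupQ F n hq hn ξ)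
    (c : NegaRing F n) : ev (g c) = 0 ↔ ev c = 0 := by
  induction hg using Subgroup.closure_induction generalizing c with
  | mem g hg =>
    rcases hg with rfl | rfl | rfl
    · rw [H.ev_frob, pow_eq_zero_iff Fintype.card_ne_zero]
    · rw [H.ev_shift, mul_eq_zero, or_iff_right (Units.ne_zero _)]
    · rw [H.ev_scalar, mul_eq_zero, or_iff_right (Units.ne_zero _)]
  | one => rfl
  | mul g g' _ _ h h' => rw [LinearEquiv.mul_apply, h, h']
  | inv g _ h => rw [← h (g⁻¹ c), ← LinearEquiv.mul_apply, mul_inv_cancel]; rfl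

lemma orbitCount_groupQ_union :
    orbitCount (groupQ F n hq hn ξ) ({c | c ∈ C ∧ ev c ≠ 0 ∧ ev' c = 0} ∪
      ({c | c ∈ C ∧ ev' c ≠ 0 ∧ ev c = 0} ∪ {c | c ∈ C ∧ ev c ≠ 0 ∧ ev' c ≠ 0})) =
    orbitCount (groupQ F n hq hn ξ) {c | c ∈ C ∧ ev c ≠ 0 ∧ ev' c = 0} +
      (orbitCount (groupQ F n hq hn ξ) {c | c ∈ C ∧ ev' c ≠ 0 ∧ ev c = 0} +
        orbitCount (groupQ F n hq hn ξ) {c | c ∈ C ∧ ev c ≠ 0 ∧ ev' c ≠ 0}) := by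
  rw [orbitCount_union, orbitCount_union]
  · rintro c ⟨-, -, h⟩ g hg ⟨-, h', -⟩
    exact h' ((H.ev_eq_zero_iff hq hn hg c).mpr h)
  · rintro c ⟨-, h₁, h₂⟩ g hg (⟨-, h₁', -⟩ | ⟨-, -, h₂'⟩)
    · exact h₁' ((H.symm.ev_eq_zero_iff hq hn hg c).mpr h₂)
    · exact h₂' ((H.symm.ev_eq_zero_iff hq hn hg c).mpr h₂)

/-- The word with coordinates (1, 0) and its image (0, 1) under μ_{-1} share an orbit of the large
group, but the small group preserves the vanishing of each coordinate. -/
lemma orbitCount_groupNegQ_lt (hμ : IsSwap C ev ev' (muNegOne F n)) {S : Set (NegaRing F n)}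
    (hS : ∀ c ∈ C, (ev c ≠ 0 ∨ ev' c ≠ 0) → c ∈ S) :
    orbitCount (groupNegQ F n hq hn ξ) S < orbitCount (groupQ F n hq hn ξ) S := by
  rw [orbitCount_eq_ncard_image, orbitCount_eq_ncard_image]
  obtain ⟨c, hc, h₁, h₂⟩ := H.surj (θ ^ (0 : ℤ) : Kˣ) 0 (Or.inr ⟨0, rfl⟩) (Or.inl rfl)
  have h₁0 : ev c ≠ 0 := by rw [h₁]; exact Units.ne_zero _
  refine Set.ncard_image_lt_of_not_injOn S (Set.toFinite _) _ _ ?_ (a := c)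
    (b := muNegOne F n c) (hS c hc (Or.inl h₁0))
    (hS _ ((hμ c).2.2 hc) (Or.inr (by rw [(hμ c).2.1]; exact h₁0))) ?_ ?_
  · intro c _ c' _ h
    obtain ⟨⟨g, hg⟩, rfl⟩ := MulAction.orbit_eq_iff.mp h
    exact MulAction.orbit_eq_iff.mpr ⟨⟨g, groupQ_le_groupNegQ hq hn ξ hg⟩, rfl⟩
  · refine Eq.symm ?_
    exact MulAction.orbit_eq_iff.mpr ⟨⟨_, muNegOne_mem_groupNegQ hq hn ξ⟩, rfl⟩
  · intro h
    obtain ⟨⟨g, hg⟩, hgc⟩ := MulAction.orbit_eq_iff.mp h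
    change g (muNegOne F n c) = c at hgc
    apply h₁0
    rw [← hgc, H.ev_eq_zero_iff hq hn hg, (hμ c).1, h₂]

variable (hξ : ∀ u : Fˣ, u ∈ Subgroup.zpowers ξ) (hμ : IsSwap C ev ev' (muNegOne F n))
include hξ hμ

/-- An element μ_{-1}g' with g' in the small group moves one axis to the other, so two words on the
same axis can only be related by the small group. -/
lemma orbitCount_groupNegQ_axis :
    orbitCount (groupNegQ F n hq hn ξ) {c | c ∈ C ∧ ev c ≠ 0 ∧ ev' c = 0} =
      orbitCount (groupQ F n hq hn ξ) {c | c ∈ C ∧ ev c ≠ 0 ∧ ev' c = 0} := by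
  rw [orbitCount_eq_ncard_image, orbitCount_eq_ncard_image]
  refine (Set.ncard_image_le_and_eq_iff _ (Set.toFinite _) _ _ ?_).2.mpr ?_
  · intro c _ c' _ h
    obtain ⟨⟨g, hg⟩, rfl⟩ := MulAction.orbit_eq_iff.mp h
    exact MulAction.orbit_eq_iff.mpr ⟨⟨g, groupQ_le_groupNegQ hq hn ξ hg⟩, rfl⟩
  · rintro c ⟨_, h₁, h₂⟩ c' ⟨_, h₁', h₂'⟩ h
    obtain ⟨⟨g, hg⟩, hgc⟩ := MulAction.orbit_eq_iff.mp h
    change g c' = c at hgc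
    rcases exists_eq_muNegOne_pow_mul hq hn hξ hg with hg' | ⟨g', hg', rfl⟩
    · exact MulAction.orbit_eq_iff.mpr ⟨⟨g, hg'⟩, hgc⟩
    · refine absurd ?_ h₁
      rw [← hgc, LinearEquiv.mul_apply, (hμ _).1, H.symm.ev_eq_zero_iff hq hn hg']
      exact h₂'

/-- Each large orbit meeting the second axis also meets the first, through μ_{-1}; the second axis
adds nothing to the count. -/
lemma orbitCount_groupNegQ_union :
    orbitCount (groupNegQ F n hq hn ξ) ({c | c ∈ C ∧ ev c ≠ 0 ∧ ev' c = 0} ∪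
      ({c | c ∈ C ∧ ev' c ≠ 0 ∧ ev c = 0} ∪ {c | c ∈ C ∧ ev c ≠ 0 ∧ ev' c ≠ 0})) =
    orbitCount (groupQ F n hq hn ξ) {c | c ∈ C ∧ ev c ≠ 0 ∧ ev' c = 0} +
        orbitCount (groupNegQ F n hq hn ξ) {c | c ∈ C ∧ ev c ≠ 0 ∧ ev' c ≠ 0} := by
  rw [← H.orbitCount_groupNegQ_axis hq hn hξ hμ, ← orbitCount_union]
  · rw [orbitCount_eq_ncard_image, orbitCount_eq_ncard_image, Set.image_union, Set.image_union,
      Set.image_union, ← Set.union_assoc]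
    congr 2
    apply Set.union_eq_left.mpr
    rintro _ ⟨c, ⟨hc, h₁, h₂⟩, rfl⟩
    refine ⟨muNegOne F n c, ⟨(hμ c).2.2 hc, ?_, ?_⟩, ?_⟩
    · rw [(hμ c).1]; exact h₁
    · rw [(hμ c).2.1]; exact h₂
    · exact MulAction.orbit_eq_iff.mpr ⟨⟨_, muNegOne_mem_groupNegQ hq hn ξ⟩, rfl⟩
  · rintro c ⟨-, h₁, h₂⟩ g hg ⟨-, h₁', h₂'⟩
    rcases exists_eq_muNegOne_pow_mul hq hn hξ hg with hg' | ⟨g', hg', rfl⟩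
    · exact h₂' ((H.symm.ev_eq_zero_iff hq hn hg' c).mpr h₂)
    · apply h₁'
      rw [LinearEquiv.mul_apply, (hμ _).1, H.symm.ev_eq_zero_iff hq hn hg']
      exact h₂

end IsPairCode
end Pair

section Arithmetic

/-- The difference (q^h + 1)E - 2E = (q^h - 1)E is a multiple of (q - 1)E = q^k - 1, hence of g.
This replaces the entry that Burnside produces by the one in the statement. -/
lemma gcd_succ_mul_eq {q k h g M E : ℕ} (hq : 1 < q) (hE : q ^ k - 1 = (q - 1) * E)
    (hg : g ∣ q ^ k - 1) :
    Nat.gcd g (Nat.gcd ((q ^ h + 1) * E) ((q ^ h - 1) * M)) =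
      Nat.gcd g (Nat.gcd (2 * E) ((q ^ h - 1) * M)) := by
  have h1 : g ∣ (q ^ h - 1) * E := by
    have : q - 1 ∣ q ^ h - 1 := by simpa using Nat.sub_dvd_pow_sub_pow q 1 h
    exact hg.trans (hE ▸ Nat.mul_dvd_mul_right this E)
  obtain ⟨t, ht⟩ := h1
  have h2 : (q ^ h + 1) * E = 2 * E + g * t := by
    rw [← ht, ← add_mul]
    congr 1
    have := Nat.one_le_pow h q (by omega)
    omega
  rw [← Nat.gcd_assoc, ← Nat.gcd_assoc, h2, Nat.gcd_add_mul_left_right]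

end Arithmetic
end NegaRing

/-! ### Assembly of the theorem -/

theorem theorem3p4 {F : Type*} [Field F] [Fintype F] {K : Type*} [Field K] [Algebra F K]
    (q n m k a : ℕ) [NeZero n] (hqF : q = Fintype.card F) (hn1 : 1 < n)
    (hq : Odd (Fintype.card F)) (hn : n.Coprime (Fintype.card F))
    (hm : m = orderOf (q : ZMod (2 * n)))
    {ξ : Fˣ} (hξ : ∀ u : Fˣ, u ∈ Subgroup.zpowers ξ)
    {ζ : K} (hζ : IsPrimitiveRoot ζ (2 * n))
    {Γ : Finset (ZMod (2 * n))}
    (hΓ : Γ = NegaRing.cyclotomicCoset (2 * n) q (1 + 2 * a)) (hk : k = Γ.card)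
    (hneg : -(1 + 2 * a : ZMod (2 * n)) ∉ Γ)
    {A B C : Submodule F (NegaRing F n)}
    (hA : A = NegaRing.irreducibleCode F n hq hn hζ (1 + 2 * a))
    (hB : B = A.map (NegaRing.muNegOne F n).toLinearMap)
    (hC : C = A ⊔ B)
    {Cstar : Set (NegaRing F n)} (hCstar : Cstar = {c | c ∈ C ∧ c ≠ 0})
    {G₃ G₄ : Subgroup (NegaRing F n ≃ₗ[F] NegaRing F n)}
    (hG₃ : G₃ = NegaRing.groupQ F n hq hn ξ)
    (hG₄ : G₄ = NegaRing.groupNegQ F n hq hn ξ) :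
    -- the sum is direct and the group acts on the code
    Disjoint A B ∧
    (∀ g ∈ G₄, C.map g.toLinearMap = C) ∧
    -- the number of orbits of the large group
    (NegaRing.orbitCount G₄ Cstar : ℚ) =
      1 / k * ∑ h ∈ k.divisors, (Nat.totient (k / h) : ℚ) *
        Nat.gcd (q ^ h - 1)
          (Nat.gcd ((q ^ k - 1) / (q - 1)) ((1 + 2 * a) * (q ^ k - 1) / (2 * n))) +
      1 / (2 * m) * ∑ h ∈ Finset.range m,
        ((Nat.gcd (q ^ Nat.gcd k (2 * h) - 1)
            (Nat.gcd (2 * (q ^ k - 1) / (q - 1))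
              ((1 + 2 * a) * (q ^ h - 1) * (q ^ k - 1) / (2 * n))) : ℚ) +
          Nat.gcd ((q ^ Nat.gcd k h - 1) * Nat.gcd (q ^ Nat.gcd k h - 1)
              (Nat.gcd ((q ^ k - 1) / (q - 1)) ((1 + 2 * a) * (q ^ k - 1) / (2 * n))))
            (2 * (1 + 2 * a) * (q ^ k - 1) ^ 2 / (2 * n * (q - 1)))) ∧
    -- it is strictly below the number of orbits of the small group, whose value is recalled
    (NegaRing.orbitCount G₃ Cstar : ℚ) =
      1 / k * ∑ h ∈ k.divisors, (Nat.totient (k / h) : ℚ) *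
        (2 * Nat.gcd (q ^ h - 1)
          (Nat.gcd ((q ^ k - 1) / (q - 1)) ((1 + 2 * a) * (q ^ k - 1) / (2 * n))) +
          Nat.gcd ((q ^ h - 1) * Nat.gcd (q ^ h - 1)
              (Nat.gcd ((q ^ k - 1) / (q - 1)) ((1 + 2 * a) * (q ^ k - 1) / (2 * n))))
            (2 * (1 + 2 * a) * (q ^ k - 1) ^ 2 / (2 * n * (q - 1)))) ∧
    NegaRing.orbitCount G₄ Cstar < NegaRing.orbitCount G₃ Cstar ∧
    -- the bound on the number of non-zero weights
    (NegaRing.weight F n '' Cstar).ncard ≤ NegaRing.orbitCount G₄ Cstar ∧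
    -- the equality criterion
    ((NegaRing.weight F n '' Cstar).ncard = NegaRing.orbitCount G₄ Cstar ↔
      ∀ c₁ ∈ Cstar, ∀ c₂ ∈ Cstar, NegaRing.weight F n c₁ = NegaRing.weight F n c₂ →
        ∃ j₀ j₁ j₂ j₃ : ℕ, j₀ ≤ 1 ∧ j₁ ≤ m - 1 ∧ j₂ ≤ n - 1 ∧ j₃ ≤ q - 2 ∧
          (NegaRing.muNegOne F n ^ j₀ * NegaRing.muQ F n hq hn ^ j₁ * NegaRing.shift F n ^ j₂ *
            NegaRing.scalar F n ξ ^ j₃) c₁ = c₂) := by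
  classical
  subst hqF hΓ hG₃ hG₄ hCstar
  have hqu : IsUnit ((Fintype.card F : ℕ) : ZMod (2 * n)) :=
    (ZMod.isUnit_iff_coprime _ _).mpr
      (Nat.isCoprime_iff_coprime.mp (NegaRing.isCoprime_card F n hq hn))
  have hm0 : m ≠ 0 := by
    obtain ⟨u, hu⟩ := hqu
    rw [hm, ← hu, orderOf_units]
    exact (orderOf_pos u).ne'
  obtain ⟨hk0, hkdvd⟩ := NegaRing.card_cyclotomicCoset_dvd_iff hqu (1 + 2 * a : ZMod (2 * n))
  rw [← hk] at hk0 hkdvd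
  have hkm : k ∣ m := by rw [← hkdvd, hm, pow_orderOf_eq_one, mul_one]
  have hCp : C = NegaRing.pairCode hq hn hζ a := by rw [hC, hB, hA]; rfl
  obtain ⟨⟨M, hM⟩, β, x, θ, H⟩ := NegaRing.exists_isPairCode hq hn hζ a hneg hξ hk
  have hμ := NegaRing.isSwap_muNegOne hq hn hζ a
  have hq1 : 1 < Fintype.card F := Fintype.one_lt_card
  obtain ⟨E, hE⟩ : Fintype.card F - 1 ∣ Fintype.card F ^ k - 1 := by
    simpa using Nat.sub_dvd_pow_sub_pow (Fintype.card F) 1 k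
  have h2n : 0 < 2 * n := by omega
  have hMdiv : (1 + 2 * a) * (Fintype.card F ^ k - 1) / (2 * n) = M := by
    rw [hM, Nat.mul_div_cancel_left _ h2n]
  have hEdiv : (Fintype.card F ^ k - 1) / (Fintype.card F - 1) = E := by
    rw [hE, Nat.mul_div_cancel_left _ (by omega)]
  have hEdiv2 : 2 * (Fintype.card F ^ k - 1) / (Fintype.card F - 1) = 2 * E := by
    rw [hE, mul_left_comm, Nat.mul_div_cancel_left _ (by omega)]
  -- All natural-number divisions in the statement are exact, because 2n divides (1+2a)(q^k - 1) and
  -- q - 1 divides q^k - 1.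
  have hMdivh : ∀ h, (1 + 2 * a) * (Fintype.card F ^ h - 1) * (Fintype.card F ^ k - 1) / (2 * n) =
      (Fintype.card F ^ h - 1) * M := by
    intro h
    rw [mul_right_comm, hM, mul_assoc, mul_comm M, Nat.mul_div_cancel_left _ h2n]
  have hME : 2 * (1 + 2 * a) * (Fintype.card F ^ k - 1) ^ 2 / (2 * n * (Fintype.card F - 1)) =
      2 * (M * E) := by
    refine Nat.div_eq_of_eq_mul_right (Nat.mul_pos h2n (by omega)) ?_
    calc 2 * (1 + 2 * a) * (Fintype.card F ^ k - 1) ^ 2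
        = 2 * (((1 + 2 * a) * (Fintype.card F ^ k - 1)) * (Fintype.card F ^ k - 1)) := by ring
      _ = 2 * ((2 * n * M) * ((Fintype.card F - 1) * E)) := by rw [hM, ← hE]
      _ = _ := by ring
  simp only [hMdiv, hEdiv, hEdiv2, hMdivh, hME] at H ⊢
  have hfinE : Finite (NegaRing F n ≃ₗ[F] NegaRing F n) := DFunLike.finite _
  set ev := NegaRing.evalAt F (NegaRing.root_pow_eq_neg_one hζ a) with hev
  set ev' := NegaRing.evalAt F
    (NegaRing.inv_pow_eq_neg_one (NegaRing.root_pow_eq_neg_one hζ a)) with hev'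
  set S : Set (NegaRing F n) := {c | c ∈ C ∧ c ≠ 0} with hS
  have hSmem : ∀ c, c ∈ S ↔ c ∈ NegaRing.pairCode hq hn hζ a ∧ (ev c ≠ 0 ∨ ev' c ≠ 0) := by
    intro c
    rw [hS, hCp]
    refine and_congr_right fun hc => ?_
    rw [← not_and_or, not_iff_not]
    constructor
    · rintro rfl; exact ⟨map_zero _, map_zero _⟩
    · rintro ⟨h1, h2⟩
      exact H.inj c hc 0 (Submodule.zero_mem _) (h1.trans (map_zero ev).symm)
        (h2.trans (map_zero ev').symm)
  have hSunion : S = {c | c ∈ (NegaRing.pairCode hq hn hζ a : Set (NegaRing F n)) ∧ ev c ≠ 0 ∧ ev' c = 0} ∪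
      ({c | c ∈ (NegaRing.pairCode hq hn hζ a : Set (NegaRing F n)) ∧ ev' c ≠ 0 ∧ ev c = 0} ∪
        {c | c ∈ (NegaRing.pairCode hq hn hζ a : Set (NegaRing F n)) ∧ ev c ≠ 0 ∧ ev' c ≠ 0}) := by
    ext c
    rw [hSmem]
    simp only [Set.mem_union, Set.mem_ofPred_eq, SetLike.mem_coe]
    tauto
  have h3 := H.orbitCount_groupQ_union hq hn
  have h4 := H.orbitCount_groupNegQ_union hq hn hξ hμ
  have hlt := H.orbitCount_groupNegQ_lt hq hn hμ (S := S)
    (fun c hc h => (hSmem c).mpr ⟨hc, h⟩)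
  rw [← hSunion] at h3 h4
  have c1 : k * NegaRing.orbitCount (NegaRing.groupQ F n hq hn ξ) _ = _ := H.orbitCount_axis
  -- The second axis gives the same sum as the first, whence the coefficient 2 for the small group.
  have c2 : k * NegaRing.orbitCount (NegaRing.groupQ F n hq hn ξ) _ = _ := H.symm.orbitCount_axis
  have c3 : k * NegaRing.orbitCount (NegaRing.groupQ F n hq hn ξ) _ = _ := H.orbitCount_torus
  have c4 : 2 * m * NegaRing.orbitCount (NegaRing.groupNegQ F n hq hn ξ) _ = _ :=
    H.orbitCount_torus_swap hm0 hkm hμ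
  have hkQ : (k : ℚ) ≠ 0 := by exact_mod_cast hk0
  have hmQ : (2 * m : ℚ) ≠ 0 := by
    have : 2 * m ≠ 0 := by omega
    exact_mod_cast this
  rw [sum_range_gcd_eq_sum_divisors k hk0 (fun g => Nat.gcd (Fintype.card F ^ g - 1) (Nat.gcd E M))]
    at c1 c2
  rw [sum_range_gcd_eq_sum_divisors k hk0 (fun g => Nat.gcd ((Fintype.card F ^ g - 1) *
    Nat.gcd (Fintype.card F ^ g - 1) (Nat.gcd E M)) (2 * (M * E)))] at c3
  have hswap : ∀ h, Nat.gcd (Fintype.card F ^ Nat.gcd k (2 * h) - 1)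
      (Nat.gcd ((Fintype.card F ^ h + 1) * E) ((Fintype.card F ^ h - 1) * M)) =
      Nat.gcd (Fintype.card F ^ Nat.gcd k (2 * h) - 1)
        (Nat.gcd (2 * E) ((Fintype.card F ^ h - 1) * M)) := by
    refine fun h => NegaRing.gcd_succ_mul_eq hq1 hE ?_
    rw [← Nat.pow_sub_one_gcd_pow_sub_one]
    exact Nat.gcd_dvd_left _ _
  simp only [hswap] at c4
  obtain ⟨hw1, hw2⟩ := S.ncard_image_le_and_eq_iff (Set.toFinite _)
    (fun c => MulAction.orbit (NegaRing.groupNegQ F n hq hn ξ) c) (NegaRing.weight F n) (by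
      intro c _ c' _ h
      obtain ⟨⟨g, hg⟩, rfl⟩ := MulAction.orbit_eq_iff.mp h
      exact NegaRing.weight_map_groupNegQ F n hq hn hg c')
  rw [← NegaRing.orbitCount_eq_ncard_image] at hw1 hw2
  refine ⟨?_, ?_, ?_, ?_, hlt, hw1, hw2.trans ?_⟩
  · rw [hB, hA]
    exact NegaRing.disjoint_irreducibleCode_map hq hn hζ a hneg
  · intro g hg
    rw [hCp]
    exact NegaRing.map_pairCode hq hn hζ a hg
  · rw [h4, Nat.cast_add]
    congr 1
    · rw [one_div, eq_inv_mul_iff_mul_eq₀ hkQ]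
      exact_mod_cast c1
    · rw [one_div, eq_inv_mul_iff_mul_eq₀ hmQ, Finset.sum_congr rfl fun h _ => add_comm _ _]
      exact_mod_cast c4
  · rw [h3, one_div, eq_inv_mul_iff_mul_eq₀ hkQ]
    have c5 := congrArg₂ (· + ·) c1 (congrArg₂ (· + ·) c2 c3)
    simp only [← mul_add, ← Finset.sum_add_distrib] at c5
    have c5Q := congrArg (Nat.cast (R := ℚ)) c5
    push_cast at c5Q ⊢
    rw [c5Q]
    refine Finset.sum_congr rfl fun h _ => ?_
    ring
  · refine forall₄_congr fun c₁ _ c₂ _ => imp_congr_right fun _ => ?_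
    constructor
    · intro h
      obtain ⟨⟨g, hg⟩, hgc⟩ := MulAction.orbit_eq_iff.mp h.symm
      obtain ⟨j₀, j₁, j₂, j₃, h₀, h₁, h₂, h₃, rfl⟩ := NegaRing.exists_normalForm F n hq hn hξ hg
      rw [← hm] at h₁
      exact ⟨j₀, j₁, j₂, j₃, by omega, by omega, by omega, by omega, hgc⟩
    · rintro ⟨j₀, j₁, j₂, j₃, -, -, -, -, rfl⟩
      refine Eq.symm ?_
      refine MulAction.orbit_eq_iff.mpr ⟨⟨_, ?_⟩, rfl⟩
      exact mul_mem (mul_mem (mul_mem (pow_mem (Subgroup.subset_closure (by simp)) _)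
        (pow_mem (Subgroup.subset_closure (by simp)) _))
        (pow_mem (Subgroup.subset_closure (by simp)) _))
        (pow_mem (Subgroup.subset_closure (by simp)) _)
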